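/- Let $S^1=\mathbb R/\mathbb Z$. For $x,y\in S^1$ let $|[x,y]|\in(0,1]$ be the length of the positively oriented segment from $x$ to $y$, with $|[x,x]|:=1$. Points $t_1,\dots,t_N\in S^1$ form an ordered family if $\sum_{i=1}^N|[t_i,t_{i+1}]|=1$, where $t_{N+1}:=t_1$. Let $\mathcal G(\mathbb R)$ be the set of right-continuous nondecreasing $F:\mathbb R\to\mathbb R$ with $F(x+1)=F(x)+1$. Let $\mathcal G$ be the set of the maps $g:S^1\to S^1$ induced by some $F\in\mathcal G(\mathbb R)$ (a lift of $g$), with the $\sigma$-algebra generated by the evaluations $g\mapsto g(t)$. For $\beta>0$ let $\mathbb Q^\beta$ be the probability measure on $\mathcal G$ under which, for each $N\ge1$ and each ordered family $t_1,\dots,t_N$, the vector $(g(t_1),\dots,g(t_N))$ has density $$\frac{\Gamma(\beta)}{\prod_{i}\Gamma(\beta|[t_i,t_{i+1}]|)}\prod_{i=1}^N|[x_i,x_{i+1}]|^{\beta|[t_i,t_{i+1}]|-1}$$ with respect to $dx_1\cdots dx_N$ on the set of ordered families $(x_1,\dots,x_N)\in(S^1)^N$. Let $\varphi\in C^\infty(S^1,\mathbb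 R)$, with flow $e_{t\varphi}$ (that is, $\partial_te_{t\varphi}(x)=\varphi(e_{t\varphi}(x))$, $e_{0}(x)=x$); write $e$ for the identity. For $g\in\mathcal G$, values of $g$ in the formulas below are those of a lift, and $J_g$ is the set of its jump points in one period $[0,1)$. For $h=e_{t\varphi}$ and for $h=e+t\varphi$ with $|t|$ small, put $$Y_h^\beta(g)=\exp\Big(\beta\int_0^1\log h'(g(s))\,ds\Big)\prod_{a\in J_g}\frac{\sqrt{h'(g(a-))\,h'(g(a+))}}{\frac{h(g(a+))-h(g(a-))}{g(a+)-g(a-)}},$$ and put $$V^0_\varphi(g)=\sum_{a\in J_g}\Big[\tfrac{\varphi'(g(a+))+\varphi'(g(a-))}{2}-\tfrac{\varphi(g(a+))-\varphi(g(a-))}{g(a+)-g(a-)}\Big],\qquad V^\beta_\varphi(g)=V^0_\varphi(g)+\beta\int_{S^1}\varphi'(g(x))\,dx .$$ (1) For every $g\in\mathcal G$ the sum $V^0_\varphi(g)$ is absolutely convergent, $V^0_\varphi(g)$ and (for $\beta\ge 0$) $V^\beta_\varphi(g)$ do not depend on the lift, and $$|V^0_\varphi(g)|\le\sum_{a\in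 J_g}\Big|\tfrac{\varphi'(g(a+))+\varphi'(g(a-))}{2}-\tfrac{\varphi(g(a+))-\varphi(g(a-))}{g(a+)-g(a-)}\Big|\le\tfrac12\int_{S^1}|\varphi''|\,dx,\qquad |V^\beta_\varphi(g)|\le(\tfrac12+\beta)\int_{S^1}|\varphi''|\,dx\quad(\beta\ge0).$$ (2) For every $g\in\mathcal G$ and every lift of $g$, the product in $Y^\beta_h(g)$ converges for $h=e_{t\varphi}$ (all $t\in\mathbb R$) and for $h=e+t\varphi$ ($|t|$ small), and for each $\beta\ge0$ $$V^\beta_\varphi(g)=\frac{\partial}{\partial t}Y^\beta_{e_{t\varphi}}(g)\Big|_{t=0}=\frac{\partial}{\partial t}Y^\beta_{e+t\varphi}(g)\Big|_{t=0}.$$ (3) Let $\beta>0$ and let $\mathfrak S^1(\mathcal G)$ be the set of functions $u(g)=U(g(x_1),\dots,g(x_m))$ with $m\in\mathbb N$, $x_i\in S^1$, $U\in C^1((S^1)^m)$. For $u\in\mathfrak S^1(\mathcal G)$ the limit $D_\varphi u(g)=\lim_{t\to0}\frac1t[u(e_{t\varphi}\circ g)-u(g)]$ exists for every $g$, and $u,D_\varphi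 u\in L^2(\mathbb Q^\beta)$. This defines a (single-valued) densely defined linear operator $D_\varphi$ in $L^2(\mathcal G,\mathbb Q^\beta)$ with domain $\mathfrak S^1(\mathcal G)$ (modulo $\mathbb Q^\beta$-a.e. equality). Its adjoint $D_\varphi^*$ satisfies $\mathfrak S^1(\mathcal G)\subset\mathrm{Dom}(D_\varphi^*)$ and $$D_\varphi^*u=-D_\varphi u-V_\varphi^\beta\cdot u\qquad\text{for all }u\in\mathfrak S^1(\mathcal G).$$ Consequently $(D_\varphi,\mathfrak S^1(\mathcal G))$ is closable in $L^2(\mathbb Q^\beta)$. -/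

import Mathlib

open Filter Topology MeasureTheory Set
open scoped ContDiff

noncomputable section

namespace CircleMap

/-! ### The circle, the spaces `𝒢(ℝ)` and `𝒢` -/

/-- The circle `S¹ = ℝ/ℤ` of length one. -/
abbrev S1 : Type := AddCircle (1 : ℝ)

/-- The length `|[x,y]| ∈ (0,1]` of the positively oriented segment from `x` to `y`. The degenerate
segment is read as the full circle, `|[x,x]| = 1`. -/
def segLen (x y : S1) : ℝ := (AddCircle.equivIoc (1 : ℝ) 0 (y - x) : ℝ)

/-- An ordered family `t₁,…,t_N` of points of the circle (indices cyclic, `t_{N+1} = t₁`). As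
`|[x,x]| = 1`, the points of such a family are distinct; for `N = 1` the condition is empty. -/
def IsOrderedFamily {N : ℕ} [NeZero N] (t : Fin N → S1) : Prop :=
  ∑ i, segLen (t i) (t (i + 1)) = 1

/-- `𝒢(ℝ)`: right continuous nondecreasing `F : ℝ → ℝ` with `F (x + 1) = F x + 1`. -/
structure IsLiftFun (F : ℝ → ℝ) : Prop where
  mono : Monotone F
  rightCont : ∀ x, ContinuousWithinAt F (Ici x) x
  add_one : ∀ x, F (x + 1) = F x + 1

/-- The map `π(F) : S¹ → S¹` induced by `F : ℝ → ℝ`. -/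
def inducedMap (F : ℝ → ℝ) (y : S1) : S1 :=
  ((F (AddCircle.equivIco (1 : ℝ) 0 y : ℝ) : ℝ) : S1)

/-- `𝒢 = π(𝒢(ℝ))`, the set of monotone maps of the circle. -/
def monotoneMaps : Set (S1 → S1) := inducedMap '' {F | IsLiftFun F}

/-- The space `𝒢`, with the σ-algebra generated by the evaluations `g ↦ g(t)`. -/
abbrev G : Type := monotoneMaps

/-- `F ∈ 𝒢(ℝ)` is a lift of `g ∈ 𝒢`. -/
def IsLift (F : ℝ → ℝ) (g : G) : Prop := IsLiftFun F ∧ inducedMap F = (g : S1 → S1)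

theorem exists_isLift (g : G) : ∃ F, IsLift F g := by
  obtain ⟨F, hF, h⟩ := g.2
  exact ⟨F, hF, h⟩

/-- Some lift of `g ∈ 𝒢`. -/
def lift (g : G) : ℝ → ℝ := Classical.choose (exists_isLift g)

theorem isLift_lift (g : G) : IsLift (lift g) g := Classical.choose_spec (exists_isLift g)

theorem IsLiftFun.add_int {F : ℝ → ℝ} (hF : IsLiftFun F) (x : ℝ) (n : ℤ) :
    F (x + n) = F x + n := by
  induction n using Int.induction_on with
  | zero => simp
  | succ n ih =>
    have := hF.add_one (x + n)
    push_cast at ih ⊢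
    rw [← add_assoc, this, ih]; ring
  | pred n ih =>
    have := hF.add_one (x + (-n - 1))
    push_cast at ih ⊢
    rw [show x + (-(n : ℝ) - 1) + 1 = x + -n by ring, ih] at this
    linarith

theorem coe_eq_coe_iff (x y : ℝ) : (x : S1) = (y : S1) ↔ ∃ n : ℤ, x = y + n := by
  rw [← sub_eq_zero, ← AddCircle.coe_sub, AddCircle.coe_eq_zero_iff]
  constructor
  · rintro ⟨n, hn⟩
    exact ⟨n, by simp at hn; linarith⟩
  · rintro ⟨n, hn⟩
    exact ⟨n, by simp; linarith⟩

theorem inducedMap_coe {F : ℝ → ℝ} (hF : IsLiftFun F) (x : ℝ) :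
    inducedMap F (x : S1) = ((F x : ℝ) : S1) := by
  unfold inducedMap
  have h1 : (((AddCircle.equivIco (1 : ℝ) 0 (x : S1) : ℝ)) : S1) = (x : S1) :=
    AddCircle.coe_equivIco
  obtain ⟨n, hn⟩ := (coe_eq_coe_iff _ _).1 h1
  rw [coe_eq_coe_iff]
  exact ⟨n, by rw [hn, hF.add_int]⟩

/-! ### The Dirichlet process `ℚ^β` -/

/-- The density of `(g(t₁),…,g(t_N))` under `ℚ^β` with respect to `dx₁ ⋯ dx_N` on `(S¹)^N`. It is
carried by the set `Σ_N` of ordered families. -/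
def dirichletDensity (β : ℝ) {N : ℕ} [NeZero N] (t x : Fin N → S1) : ℝ :=
  open Classical in
  if IsOrderedFamily x then
    Real.Gamma β / (∏ i, Real.Gamma (β * segLen (t i) (t (i + 1)))) *
      ∏ i, segLen (x i) (x (i + 1)) ^ (β * segLen (t i) (t (i + 1)) - 1)
  else 0

/-- `Q` is the Dirichlet process `ℚ^β` on `𝒢`: the probability measure with the prescribed finite
dimensional distributions. -/
structure IsDirichletProcess (β : ℝ) (Q : Measure G) : Prop where
  isProb : IsProbabilityMeasure Q
  fidi : ∀ (N : ℕ) [NeZero N] (t : Fin N → S1), IsOrderedFamily t →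
    Q.map (fun (g : G) (i : Fin N) => (g : S1 → S1) (t i)) =
      (Measure.pi fun _ : Fin N => (volume : Measure S1)).withDensity
        (fun x => ENNReal.ofReal (dirichletDensity β t x))

/-! ### Jumps, the densities `Y_h^β` and the drift `V_φ^β` -/

/-- The jump locations of a lift in one period. The one-sided limits at `a` are
`F(a-) = Function.leftLim F a` and, by right continuity, `F(a+) = F a`. -/
def jumpSet (F : ℝ → ℝ) : Set ℝ := {a | a ∈ Ico (0 : ℝ) 1 ∧ Function.leftLim F a ≠ F a}

/-- The difference quotient `(h(F(a+)) - h(F(a-))) / (F(a+) - F(a-))`. -/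
def jumpQuot (h F : ℝ → ℝ) (a : ℝ) : ℝ :=
  (h (F a) - h (Function.leftLim F a)) / (F a - Function.leftLim F a)

/-- The factor of `Y⁰_h(F)` at the jump `a`. -/
def jumpFactor (h F : ℝ → ℝ) (a : ℝ) : ℝ :=
  √(deriv h (Function.leftLim F a) * deriv h (F a)) / jumpQuot h F a

/-- `Y⁰_h`, for a (lifted) circle map `h` and a lift `F`. -/
def Y0 (h F : ℝ → ℝ) : ℝ := ∏' a : jumpSet F, jumpFactor h F a

/-- `X^β_h`. -/
def Xdens (β : ℝ) (h F : ℝ → ℝ) : ℝ :=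
  Real.exp (β * ∫ s in (0 : ℝ)..1, Real.log (deriv h (F s)))

/-- `Y^β_h = X^β_h · Y⁰_h`. -/
def Ydens (β : ℝ) (h F : ℝ → ℝ) : ℝ := Xdens β h F * Y0 h F

/-- The summand of `V⁰_φ` at the jump `a`. -/
def driftTerm (φ F : ℝ → ℝ) (a : ℝ) : ℝ :=
  (deriv φ (F a) + deriv φ (Function.leftLim F a)) / 2 - jumpQuot φ F a

/-- `V⁰_φ(g)`. -/
def drift0 (φ : ℝ → ℝ) (g : G) : ℝ := ∑' a : jumpSet (lift g), driftTerm φ (lift g) a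

/-- The drift `V^β_φ(g) = V⁰_φ(g) + β ∫_{S¹} φ'(g(x)) dx`. -/
def drift (β : ℝ) (φ : ℝ → ℝ) (g : G) : ℝ :=
  drift0 φ g + β * ∫ x in (0 : ℝ)..1, deriv φ (lift g x)

/-! ### The flow of a smooth vector field on the circle -/

/-- `𝒞^∞(S¹,ℝ)`, as the smooth `1`-periodic functions on the line. -/
structure SmoothFun where
  toFun : ℝ → ℝ
  smooth : ContDiff ℝ ∞ toFun
  periodic : Function.Periodic toFun 1

instance : CoeFun SmoothFun (fun _ => ℝ → ℝ) := ⟨SmoothFun.toFun⟩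

namespace SmoothFun

variable (φ : SmoothFun)

theorem exists_bound {f : ℝ → ℝ} (hc : Continuous f) (hp : Function.Periodic f 1) :
    ∃ C : NNReal, ∀ x, ‖f x‖ ≤ C := by
  obtain ⟨C, hC⟩ := (isCompact_Icc (a := (0 : ℝ)) (b := 1)).exists_bound_of_continuousOn
    hc.continuousOn
  refine ⟨C.toNNReal, fun x => ?_⟩
  obtain ⟨y, hy, hxy⟩ := hp.exists_mem_Ico₀ one_pos x
  rw [hxy]
  exact (hC y (Ico_subset_Icc_self hy)).trans (Real.le_coe_toNNReal C)

theorem exists_lipschitz : ∃ K : NNReal, LipschitzWith K φ := by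
  have h1 : Continuous (deriv φ) := φ.smooth.continuous_deriv (by simp)
  have h2 : Function.Periodic (deriv φ) 1 := by
    intro x
    rw [← deriv_comp_add_const]
    congr 1
    funext y
    exact φ.periodic y
  obtain ⟨K, hK⟩ := exists_bound h1 h2
  exact ⟨K, lipschitzWith_of_nnnorm_deriv_le (φ.smooth.differentiable (by simp)) hK⟩

theorem unique {γ δ : ℝ → ℝ} (hγ : ∀ t, HasDerivAt γ (φ (γ t)) t)
    (hδ : ∀ t, HasDerivAt δ (φ (δ t)) t) {s : ℝ} (h : γ s = δ s) : γ = δ := by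
  obtain ⟨K, hK⟩ := φ.exists_lipschitz
  exact ODE_solution_unique_univ (v := fun _ => φ) (s := fun _ => univ) (K := K)
    (fun _ => hK.lipschitzOnWith) (fun t => ⟨hγ t, mem_univ _⟩) (fun t => ⟨hδ t, mem_univ _⟩) h

/-- Global solvability of `ẋ = φ(x)`, `x₀ = x`. -/
theorem exists_flow (x : ℝ) : ∃ γ : ℝ → ℝ, γ 0 = x ∧ ∀ t, HasDerivAt γ (φ (γ t)) t := by
  obtain ⟨K, hK⟩ := φ.exists_lipschitz
  obtain ⟨L, hL⟩ := exists_bound φ.smooth.continuous φ.periodic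
  have key : ∀ n : ℕ, ∃ α : ℝ → ℝ, α 0 = x ∧
      ∀ t ∈ Ioo (-((n : ℝ) + 1)) (n + 1), HasDerivAt α (φ (α t)) t := by
    intro n
    have hn : (0 : ℝ) ∈ Icc (-((n : ℝ) + 1)) (n + 1) := by
      constructor <;> linarith [n.cast_nonneg (α := ℝ)]
    have hpl : IsPicardLindelof (fun _ => φ) (⟨0, hn⟩ : Icc (-((n : ℝ) + 1)) (n + 1)) x
        (L * (n + 1)) 0 L K := by
      refine IsPicardLindelof.of_time_independent (fun y _ => hL y) hK.lipschitzOnWith ?_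
      simp
    obtain ⟨α, h0, hα⟩ := hpl.exists_eq_forall_mem_Icc_hasDerivWithinAt₀
    exact ⟨α, h0, fun t ht => (hα t (Ioo_subset_Icc_self ht)).hasDerivAt (Icc_mem_nhds ht.1 ht.2)⟩
  choose α h0 hα using key
  have agree : ∀ m n : ℕ, m ≤ n → ∀ t ∈ Ioo (-((m : ℝ) + 1)) (m + 1), α m t = α n t := by
    intro m n hmn
    have hmn' : (m : ℝ) ≤ n := by exact_mod_cast hmn
    refine ODE_solution_unique_of_mem_Ioo (v := fun _ => φ) (s := fun _ => univ) (K := K)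
      (t₀ := 0) (fun _ _ => hK.lipschitzOnWith) ?_ (fun t ht => ⟨hα m t ht, mem_univ _⟩)
      (fun t ht => ⟨hα n t ⟨by linarith [ht.1], by linarith [ht.2]⟩, mem_univ _⟩) ?_
    · constructor <;> linarith [m.cast_nonneg (α := ℝ)]
    · rw [h0, h0]
  refine ⟨fun t => α ⌊|t|⌋₊ t, by simp [h0], fun t => ?_⟩
  set N := ⌊|t|⌋₊ + 1 with hN
  have hmem : ∀ s, s ∈ Ioo (-((⌊|s|⌋₊ : ℝ) + 1)) (⌊|s|⌋₊ + 1) := fun s =>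
    abs_lt.1 (Nat.lt_floor_add_one |s|)
  have hloc : ∀ s ∈ Ioo (-(N : ℝ)) N, α ⌊|s|⌋₊ s = α N s := by
    intro s hs
    refine agree _ _ ?_ s (hmem s)
    have : |s| < N := abs_lt.2 hs
    exact ((Nat.floor_lt (abs_nonneg s)).2 this).le
  have htN : t ∈ Ioo (-(N : ℝ)) N := by
    have := hmem t
    rw [hN]; push_cast; exact this
  have hd : HasDerivAt (α N) (φ (α N t)) t :=
    hα N t ⟨by linarith [htN.1], by linarith [htN.2]⟩
  have he : (fun s => α ⌊|s|⌋₊ s) =ᶠ[𝓝 t] α N :=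
    Filter.eventually_of_mem (Ioo_mem_nhds htN.1 htN.2) hloc
  show HasDerivAt (fun s => α ⌊|s|⌋₊ s) (φ (α ⌊|t|⌋₊ t)) t
  rw [hloc t htN]
  exact hd.congr_of_eventuallyEq he

/-- The flow `e_{tφ} : ℝ → ℝ` (lifted to the line): `t ↦ flow φ t x` is the solution of
`ẋ = φ(x)` with `x₀ = x`. -/
def flow (t x : ℝ) : ℝ := Classical.choose (φ.exists_flow x) t

theorem flow_zero (x : ℝ) : φ.flow 0 x = x := (Classical.choose_spec (φ.exists_flow x)).1

theorem hasDerivAt_flow (x t : ℝ) : HasDerivAt (fun s => φ.flow s x) (φ (φ.flow t x)) t :=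
  (Classical.choose_spec (φ.exists_flow x)).2 t

theorem flow_add_one (t x : ℝ) : φ.flow t (x + 1) = φ.flow t x + 1 := by
  have : (fun s => φ.flow s (x + 1)) = fun s => φ.flow s x + 1 := by
    refine φ.unique (fun s => φ.hasDerivAt_flow _ s) (fun s => ?_) (s := 0) ?_
    · rw [φ.periodic]
      exact (φ.hasDerivAt_flow x s).add_const 1
    · simp [flow_zero]
  exact congrFun this t

theorem flow_flow_neg (t x : ℝ) : φ.flow t (φ.flow (-t) x) = x := by
  have : (fun s => φ.flow s (φ.flow (-t) x)) = fun s => φ.flow (s - t) x := by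
    refine φ.unique (fun s => φ.hasDerivAt_flow _ s) (fun s => ?_) (s := 0) ?_
    · exact (φ.hasDerivAt_flow x (s - t)).comp_sub_const s t
    · simp [flow_zero]
  have h := congrFun this t
  simpa [flow_zero] using h

theorem flow_strictMono (t : ℝ) : StrictMono (φ.flow t) := by
  intro x y hxy
  by_contra hcon
  push Not at hcon
  have hc : Continuous fun s => φ.flow s y - φ.flow s x :=
    (continuous_iff_continuousAt.2 fun s => (φ.hasDerivAt_flow y s).continuousAt).sub
      (continuous_iff_continuousAt.2 fun s => (φ.hasDerivAt_flow x s).continuousAt)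
  have hz : (0 : ℝ) ∈ uIcc (φ.flow t y - φ.flow t x) (φ.flow 0 y - φ.flow 0 x) := by
    rw [mem_uIcc]
    left
    simp only [flow_zero]
    constructor <;> linarith
  obtain ⟨s, -, hs⟩ := intermediate_value_uIcc (a := t) (b := 0) hc.continuousOn hz
  have h := φ.unique (fun r => φ.hasDerivAt_flow y r) (fun r => φ.hasDerivAt_flow x r) (s := s)
    (by simpa [sub_eq_zero] using hs)
  have := congrFun h 0
  simp only [flow_zero] at this
  exact hxy.ne' this

theorem continuous_flow (t : ℝ) : Continuous (φ.flow t) :=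
  (φ.flow_strictMono t).monotone.continuous_of_surjective
    fun x => ⟨φ.flow (-t) x, φ.flow_flow_neg t x⟩

theorem isLiftFun_flow (t : ℝ) : IsLiftFun (φ.flow t) :=
  ⟨(φ.flow_strictMono t).monotone, fun _ => (φ.continuous_flow t).continuousWithinAt,
    φ.flow_add_one t⟩

end SmoothFun

/-- If `H, F ∈ 𝒢(ℝ)` and `H` is continuous then `H ∘ F ∈ 𝒢(ℝ)`. -/
theorem IsLiftFun.comp {H F : ℝ → ℝ} (hH : IsLiftFun H) (hc : Continuous H) (hF : IsLiftFun F) :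
    IsLiftFun (H ∘ F) :=
  ⟨hH.mono.comp hF.mono, fun x => hc.continuousAt.comp_continuousWithinAt (hF.rightCont x),
    fun x => by simp [hF.add_one, hH.add_one]⟩

theorem inducedMap_comp {H : ℝ → ℝ} (hH : IsLiftFun H) (F : ℝ → ℝ) :
    inducedMap H ∘ inducedMap F = inducedMap (H ∘ F) := by
  funext y
  exact inducedMap_coe hH _

/-- `e_{tφ} ∘ g` for `g ∈ 𝒢`. -/
def flowComp (φ : SmoothFun) (t : ℝ) (g : G) : G :=
  ⟨inducedMap (φ.flow t) ∘ (g : S1 → S1), by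
    obtain ⟨F, hF, h⟩ := g.2
    exact ⟨φ.flow t ∘ F, (φ.isLiftFun_flow t).comp (φ.continuous_flow t) hF, by
      rw [← h, inducedMap_comp (φ.isLiftFun_flow t)]⟩⟩

/-! ### Cylinder functions and the operator `D_φ` -/

/-- The class `𝔖^k(𝒢)` of cylinder functions `u(g) = U(g(x₁),…,g(x_m))` with
`U : (S¹)^m → ℝ` of class `C^k`. -/
def IsCylinder (k : WithTop ℕ∞) (u : G → ℝ) : Prop :=
  ∃ (m : ℕ) (x : Fin m → S1) (U : (Fin m → S1) → ℝ),
    ContDiff ℝ k (fun y : Fin m → ℝ => U fun i => (y i : S1)) ∧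
      ∀ g : G, u g = U fun i => (g : S1 → S1) (x i)

/-- The difference quotient `(u(e_{tφ} ∘ g) - u(g)) / t`. -/
def diffQuot (φ : SmoothFun) (u : G → ℝ) (g : G) (t : ℝ) : ℝ :=
  (u (flowComp φ t g) - u g) / t

/-- The directional derivative `D_φ u(g) = lim_{t → 0} (u(e_{tφ} ∘ g) - u(g)) / t`. -/
def dirDeriv (φ : SmoothFun) (u : G → ℝ) (g : G) : ℝ := limUnder (𝓝[≠] 0) (diffQuot φ u g)

/-- The set of pairs `(u, D_φ u)`, `u ∈ 𝔖¹(𝒢)`, in `L²(𝒢,Q) × L²(𝒢,Q)`. -/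
def dirGraph (φ : SmoothFun) (Q : Measure G) : Set (Lp ℝ 2 Q × Lp ℝ 2 Q) :=
  {p | ∃ u : G → ℝ, IsCylinder 1 u ∧ p.1 =ᵐ[Q] u ∧ p.2 =ᵐ[Q] dirDeriv φ u}

/-- The operator `D_φ` in `L²(𝒢,Q)` with domain `𝔖¹(𝒢)`, as the partially defined linear map with
graph `dirGraph φ Q`. -/
def dirOp (φ : SmoothFun) (Q : Measure G) : Lp ℝ 2 Q →ₗ.[ℝ] Lp ℝ 2 Q :=
  (Submodule.span ℝ (dirGraph φ Q)).toLinearPMap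

end CircleMap

end

open CircleMap

noncomputable section

namespace CircleMap

/-! ### Calculus of periodic functions: average slopes and trapezoid errors. -/

namespace SmoothFun

variable (φ : SmoothFun)

/-! Everything rests on the relative error of the trapezoid rule, `trapErr a b`, which is the drift
term of a jump from `a` to `b`. The identity `mul_trapErr` writes `(b - a) * trapErr a b` as the
integral of `φ''` against the centred kernel `x - (a + b) / 2`. Hence `|trapErr a b|` is at most
half the integral of `|φ''|` over `[a, b]`, and also `O(b - a)` and `O((b - a)²)`. The intervals
jumped over by a lift are disjoint within one period, which gives the summability and the bounds.

For the derivative of the densities, the distance of two trajectories of the flow is multiplied by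
the exponential of the time integral of the average slope between them (`flow_sub_flow`). Each jump
factor is therefore the exponential of a function whose time derivative is a trapezoid error,
bounded by a constant times the jump, and the product is differentiated termwise. For `e + tφ` the
exponents are logarithms of `1 + tv`.

For the process, take the regular partition into `N` cells. The Dirichlet law of the values there is
quasi-invariant under the diagonal flow, with an explicit density. Differentiating the change of
variables at time zero yields integration by parts with drift `cellSum + β * cellMean`
(`logDens'_eq`), a sum of trapezoid errors over the cells plus `β` times a mean of slopes. As `N →
∞` this converges boundedly, for every lift, to the drift: `trapErr a b / (b - a)` extends
continuously by zero to the diagonal, so its Riemann–Stieltjes sums against `dF` retain only the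
atoms of `dF` (`tendsto_cellSum`). Evaluation points are approximated from the right by partition
points, and `integral_dirDeriv_add` follows by dominated convergence. The same limit gives
independence of the lift, because the cell sums of two lifts agree.

The Leibniz rule turns this identity into the adjoint formula on cylinder functions. They are dense,
since they determine finite measures by Stone–Weierstrass. So the operator is single-valued, its
adjoint is densely defined, and the operator is contained in the closed adjoint of its adjoint
(`isClosable_dirOp`). -/

theorem contDiff_deriv : ContDiff ℝ ∞ (deriv φ) :=
  (contDiff_infty_iff_deriv.1 φ.smooth).2

theorem periodic_deriv_of_periodic {f : ℝ → ℝ} (hf : Function.Periodic f 1) :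
    Function.Periodic (deriv f) 1 := by
  intro x
  rw [← deriv_comp_add_const]
  congr 1
  funext y
  exact hf y

/-- The derivative of a smooth function on the circle. -/
def der : SmoothFun := ⟨deriv φ, φ.contDiff_deriv, periodic_deriv_of_periodic φ.periodic⟩

@[simp] theorem der_apply (x : ℝ) : φ.der x = deriv φ x := rfl

theorem coe_der : (φ.der : ℝ → ℝ) = deriv φ := rfl

theorem continuous : Continuous φ := φ.smooth.continuous

theorem hasDerivAt (x : ℝ) : HasDerivAt φ (deriv φ x) x :=
  (φ.smooth.differentiable (by simp) x).hasDerivAt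

theorem continuous_deriv : Continuous (deriv φ) := φ.der.continuous

theorem continuous_deriv_deriv : Continuous (deriv (deriv φ)) := φ.der.continuous_deriv

theorem add_int (x : ℝ) (n : ℤ) : φ (x + n) = φ x := by
  simpa using φ.periodic.int_mul n x

theorem exists_abs_le : ∃ C : ℝ, 0 ≤ C ∧ ∀ x, |φ x| ≤ C := by
  obtain ⟨C, hC⟩ := exists_bound φ.continuous φ.periodic
  exact ⟨C, C.2, hC⟩

theorem exists_abs_sub_le : ∃ C : ℝ, 0 ≤ C ∧ ∀ x y, |φ x - φ y| ≤ C * |x - y| := by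
  obtain ⟨K, hK⟩ := φ.exists_lipschitz
  exact ⟨K, K.2, fun x y => by simpa [Real.dist_eq] using hK.dist_le_mul x y⟩

/-- The average of `φ'` over the segment from `a` to `b`, that is, the difference quotient of `φ`
if `a ≠ b`. -/
def avgSlope (a b : ℝ) : ℝ := ∫ θ in (0 : ℝ)..1, deriv φ (a + θ * (b - a))

theorem mul_avgSlope (a b : ℝ) : (b - a) * φ.avgSlope a b = φ b - φ a := by
  unfold avgSlope
  have h := intervalIntegral.integral_eq_sub_of_hasDerivAt (a := 0) (b := 1)
    (f := fun θ => φ (a + θ * (b - a))) (f' := fun θ => (b - a) * deriv φ (a + θ * (b - a)))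
    (fun θ _ => by
      have h1 : HasDerivAt (fun θ : ℝ => a + θ * (b - a)) (b - a) θ := by
        simpa using ((hasDerivAt_id θ).mul_const (b - a)).const_add a
      have := (φ.hasDerivAt (a + θ * (b - a))).comp θ h1
      rwa [mul_comm] at this)
    (by
      apply Continuous.intervalIntegrable
      have := φ.continuous_deriv
      fun_prop)
  rw [intervalIntegral.integral_const_mul] at h
  simpa using h

theorem avgSlope_eq_div {a b : ℝ} (h : a ≠ b) : φ.avgSlope a b = (φ b - φ a) / (b - a) := by
  rw [← φ.mul_avgSlope, mul_div_cancel_left₀ _ (sub_ne_zero.2 h.symm)]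

@[simp] theorem avgSlope_self (a : ℝ) : φ.avgSlope a a = deriv φ a := by simp [avgSlope]

theorem avgSlope_add_one (a : ℝ) : φ.avgSlope a (a + 1) = 0 := by
  have := φ.mul_avgSlope a (a + 1)
  rw [φ.periodic] at this
  simpa using this

theorem avgSlope_add_int (a b : ℝ) (n : ℤ) : φ.avgSlope (a + n) (b + n) = φ.avgSlope a b := by
  unfold avgSlope
  congr 1
  funext θ
  rw [← φ.der_apply, ← φ.der_apply, ← φ.der.add_int (a + θ * (b - a)) n]
  congr 1; ring

theorem continuous_avgSlope : Continuous fun p : ℝ × ℝ => φ.avgSlope p.1 p.2 := by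
  have := φ.continuous_deriv
  unfold avgSlope
  apply intervalIntegral.continuous_parametric_intervalIntegral_of_continuous'
  unfold Function.uncurry
  fun_prop

theorem abs_avgSlope_le {C : ℝ} (hC : ∀ x, |deriv φ x| ≤ C) (a b : ℝ) : |φ.avgSlope a b| ≤ C := by
  have := intervalIntegral.norm_integral_le_of_norm_le_const (a := (0 : ℝ)) (b := 1)
    (f := fun θ => deriv φ (a + θ * (b - a))) (C := C) fun θ _ => hC _
  simpa [avgSlope] using this

/-- The relative error of the trapezoid rule for `φ'` on the segment from `a` to `b`. -/
def trapErr (a b : ℝ) : ℝ := (deriv φ b + deriv φ a) / 2 - φ.avgSlope a b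

@[simp] theorem trapErr_self (a : ℝ) : φ.trapErr a a = 0 := by simp [trapErr]

theorem trapErr_add_one (a : ℝ) : φ.trapErr a (a + 1) = deriv φ a := by
  have := φ.der.periodic a
  simp only [der_apply] at this
  rw [trapErr, avgSlope_add_one, this]; ring

theorem trapErr_add_int (a b : ℝ) (n : ℤ) : φ.trapErr (a + n) (b + n) = φ.trapErr a b := by
  have h1 := φ.der.add_int a n
  have h2 := φ.der.add_int b n
  simp only [der_apply] at h1 h2
  rw [trapErr, avgSlope_add_int, h1, h2, trapErr]

theorem continuous_trapErr : Continuous fun p : ℝ × ℝ => φ.trapErr p.1 p.2 := by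
  have := φ.continuous_deriv
  have := φ.continuous_avgSlope
  unfold trapErr
  fun_prop

/-- Integration by parts with the primitive of `1` that vanishes at the midpoint: its boundary
values `±(b - a) / 2` produce the trapezoid rule. -/
theorem mul_trapErr (a b : ℝ) :
    (b - a) * φ.trapErr a b = ∫ x in a..b, (x - (a + b) / 2) * deriv (deriv φ) x := by
  rw [intervalIntegral.integral_mul_deriv_eq_deriv_mul (u := fun x => x - (a + b) / 2)
    (v := deriv φ) (v' := deriv (deriv φ)) (u' := fun _ => 1)
    (fun x _ => (hasDerivAt_id x).sub_const _) (fun x _ => φ.der.hasDerivAt x) (by simp)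
    (φ.continuous_deriv_deriv.intervalIntegrable _ _)]
  simp only [one_mul]
  rw [intervalIntegral.integral_eq_sub_of_hasDerivAt (fun x _ => φ.hasDerivAt x)
    (φ.continuous_deriv.intervalIntegrable _ _), ← φ.mul_avgSlope, trapErr]
  ring

/-- The kernel is at most `(b - a) / 2` in absolute value. The bound is local, so it can be summed
over disjoint intervals without losing the constant `1 / 2`. -/
theorem abs_trapErr_le_integral {a b : ℝ} (h : a ≤ b) :
    |φ.trapErr a b| ≤ 1 / 2 * ∫ x in a..b, |deriv (deriv φ) x| := by
  rcases h.eq_or_lt with rfl | h'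
  · simp
  have hc := φ.continuous_deriv_deriv
  have h1 : |(b - a) * φ.trapErr a b| ≤ ∫ x in a..b, (b - a) / 2 * |deriv (deriv φ) x| := by
    rw [mul_trapErr]
    refine (intervalIntegral.abs_integral_le_integral_abs h).trans ?_
    refine intervalIntegral.integral_mono_on h (by apply Continuous.intervalIntegrable; fun_prop)
      (by apply Continuous.intervalIntegrable; fun_prop) fun x hx => ?_
    rw [abs_mul]
    refine mul_le_mul_of_nonneg_right ?_ (abs_nonneg _)
    rw [abs_le]; constructor <;> linarith [hx.1, hx.2]
  rw [intervalIntegral.integral_const_mul, abs_mul, abs_of_pos (sub_pos.2 h')] at h1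
  rw [← mul_le_mul_iff_right₀ (sub_pos.2 h')]
  linarith

/-- The linear bound makes sums over jumps or cells converge or stay bounded. The quadratic one
makes `trapErr a b / (b - a)` tend to zero at the diagonal. `C₁` bounds `φ''` and `C₂` is a
Lipschitz constant of `φ''`. -/
theorem exists_abs_trapErr_le : ∃ C : ℝ, 0 ≤ C ∧ ∀ a b, a ≤ b →
    |φ.trapErr a b| ≤ C * (b - a) ∧ |φ.trapErr a b| ≤ C * (b - a) ^ 2 := by
  obtain ⟨C₁, hC₁, h₁⟩ := φ.der.der.exists_abs_le
  obtain ⟨C₂, hC₂, h₂⟩ := φ.der.der.exists_abs_sub_le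
  simp only [coe_der] at h₁ h₂
  have hc := φ.continuous_deriv_deriv
  refine ⟨C₁ + C₂, by positivity, fun a b h => ?_⟩
  have hba : 0 ≤ b - a := sub_nonneg.2 h
  constructor
  · have h3 := φ.abs_trapErr_le_integral h
    have h4 : ∫ x in a..b, |deriv (deriv φ) x| ≤ ∫ x in a..b, C₁ :=
      intervalIntegral.integral_mono_on h (by apply Continuous.intervalIntegrable; fun_prop)
        (by simp) fun x _ => h₁ x
    simp only [intervalIntegral.integral_const, smul_eq_mul] at h4
    nlinarith [mul_nonneg hba hC₁, mul_nonneg hba hC₂]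
  · rcases h.eq_or_lt with rfl | h'
    · simp
    -- The kernel has mean zero, so the value of `φ''` at the midpoint can be subtracted; the
    -- Lipschitz bound then gains a factor `b - a`.
    have h0 : ∫ x in a..b, (x - (a + b) / 2) * deriv (deriv φ) ((a + b) / 2) = 0 := by
      rw [intervalIntegral.integral_mul_const, intervalIntegral.integral_sub (by simp) (by simp)]
      simp; left; ring
    have h1 : |(b - a) * φ.trapErr a b| ≤ C₂ * (b - a) ^ 2 * |b - a| := by
      rw [mul_trapErr, ← sub_zero (∫ x in a..b, _), ← h0, ← intervalIntegral.integral_sub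
        (by apply Continuous.intervalIntegrable; fun_prop)
        (by apply Continuous.intervalIntegrable; fun_prop)]
      rw [← Real.norm_eq_abs]
      refine intervalIntegral.norm_integral_le_of_norm_le_const fun x hx => ?_
      rw [uIoc_of_le h] at hx
      have h5 : |x - (a + b) / 2| ≤ b - a := by
        rw [abs_le]; constructor <;> linarith [hx.1, hx.2]
      rw [Real.norm_eq_abs, ← mul_sub, abs_mul]
      calc |x - (a + b) / 2| * |_| ≤ (b - a) * (C₂ * (b - a)) :=
            mul_le_mul h5 ((h₂ _ _).trans (mul_le_mul_of_nonneg_left h5 hC₂)) (abs_nonneg _) hba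
        _ = C₂ * (b - a) ^ 2 := by ring
    rw [abs_mul, abs_of_nonneg hba] at h1
    have h6 : |φ.trapErr a b| ≤ C₂ * (b - a) ^ 2 := by
      rw [← mul_le_mul_iff_right₀ (sub_pos.2 h')]; linarith
    nlinarith [mul_nonneg hC₁ (sq_nonneg (b - a))]

/-- By Rolle, `φ'` vanishes somewhere in the period ending at `x`; integrate `φ''` from there. -/
theorem abs_deriv_le_integral (x : ℝ) : |deriv φ x| ≤ ∫ y in (0 : ℝ)..1, |deriv (deriv φ) y| := by
  have hc := φ.continuous_deriv_deriv
  obtain ⟨c, hc1, hc2⟩ := exists_deriv_eq_zero (f := φ) (a := x - 1) (b := x) (by linarith)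
    φ.continuous.continuousOn (by rw [← φ.periodic (x - 1)]; simp)
  have h1 := intervalIntegral.integral_eq_sub_of_hasDerivAt (a := c) (b := x)
    (fun y _ => φ.der.hasDerivAt y) (φ.continuous_deriv_deriv.intervalIntegrable _ _)
  simp only [coe_der, hc2, sub_zero] at h1
  rw [← h1]
  refine (intervalIntegral.abs_integral_le_integral_abs hc1.2.le).trans ?_
  have hp : Function.Periodic (fun y => |deriv (deriv φ) y|) 1 := fun y => by
    have := φ.der.der.periodic y
    simp only [coe_der] at this
    simp [this]
  have h2 := hp.intervalIntegral_add_eq (x - 1) 0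
  simp only [sub_add_cancel, zero_add] at h2
  rw [← h2]
  exact intervalIntegral.integral_mono_interval hc1.1.le hc1.2.le le_rfl
    (ae_of_all _ fun _ => abs_nonneg _) (by apply Continuous.intervalIntegrable; fun_prop)

/-! ### The flow as a function of space and time -/

theorem continuous_flow_time (x : ℝ) : Continuous fun s => φ.flow s x :=
  continuous_iff_continuousAt.2 fun s => (φ.hasDerivAt_flow x s).continuousAt

theorem flow_add_int (t x : ℝ) (n : ℤ) : φ.flow t (x + n) = φ.flow t x + n :=
  (φ.isLiftFun_flow t).add_int x n

theorem hasDerivAt_integral_time {q : ℝ → ℝ} (hq : Continuous q) (t : ℝ) :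
    HasDerivAt (fun t => ∫ s in (0 : ℝ)..t, q s) (q t) t :=
  intervalIntegral.integral_hasDerivAt_right (hq.intervalIntegrable _ _)
    (hq.stronglyMeasurableAtFilter _ _) hq.continuousAt

theorem continuous_avgSlope_flow (x y : ℝ) :
    Continuous fun s => φ.avgSlope (φ.flow s x) (φ.flow s y) :=
  φ.continuous_avgSlope.comp ((φ.continuous_flow_time x).prodMk (φ.continuous_flow_time y))

/-- The logarithm of the distortion of the segment from `x` to `y` under the flow. -/
def logDist (x y t : ℝ) : ℝ := ∫ s in (0 : ℝ)..t, φ.avgSlope (φ.flow s x) (φ.flow s y)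

theorem hasDerivAt_logDist (x y t : ℝ) :
    HasDerivAt (φ.logDist x y) (φ.avgSlope (φ.flow t x) (φ.flow t y)) t :=
  hasDerivAt_integral_time (φ.continuous_avgSlope_flow x y) t

@[simp] theorem logDist_zero (x y : ℝ) : φ.logDist x y 0 = 0 := by simp [logDist]

theorem logDist_add_int (x y t : ℝ) (n : ℤ) : φ.logDist (x + n) (y + n) t = φ.logDist x y t := by
  simp only [logDist, flow_add_int, avgSlope_add_int]

/-- The difference of two trajectories solves the linear equation `z' = avgSlope · z`;
multiplication by the integrating factor makes it constant. -/
theorem flow_sub_flow (t x y : ℝ) :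
    φ.flow t y - φ.flow t x = (y - x) * Real.exp (φ.logDist x y t) := by
  have hd : ∀ s, HasDerivAt
      (fun s => (φ.flow s y - φ.flow s x) * Real.exp (-φ.logDist x y s)) 0 s := by
    intro s
    refine (((φ.hasDerivAt_flow y s).sub (φ.hasDerivAt_flow x s)).mul
      (φ.hasDerivAt_logDist x y s).neg.exp).congr_deriv ?_
    simp only [Pi.sub_apply, Pi.neg_apply]
    linear_combination -Real.exp (-φ.logDist x y s) *
      φ.mul_avgSlope (φ.flow s x) (φ.flow s y)
  have hconst := is_const_of_deriv_eq_zero (fun s => (hd s).differentiableAt)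
    (fun s => (hd s).deriv) t 0
  simp only [flow_zero, logDist_zero, neg_zero, Real.exp_zero, mul_one] at hconst
  rw [← hconst, mul_assoc, ← Real.exp_add]
  simp

theorem continuous_logDist (x t : ℝ) : Continuous fun y => φ.logDist x y t := by
  obtain ⟨K, -, hK⟩ := φ.der.exists_abs_le
  refine continuous_iff_continuousAt.2 fun y => ?_
  refine intervalIntegral.continuousAt_of_dominated_interval (bound := fun _ => K)
    (Eventually.of_forall fun y => (φ.continuous_avgSlope_flow x y).aestronglyMeasurable)
    (Eventually.of_forall fun y => ae_of_all _ fun s _ => φ.abs_avgSlope_le hK _ _) (by simp)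
    (ae_of_all _ fun s _ => ?_)
  exact (φ.continuous_avgSlope.comp (continuous_const.prodMk (φ.continuous_flow s))).continuousAt

/-- By `flow_sub_flow` the difference quotient equals `exp (logDist x y t)`, so differentiability in
the initial value reduces to continuity of `logDist` at `y = x`. -/
theorem hasDerivAt_flow_space (t x : ℝ) :
    HasDerivAt (φ.flow t) (Real.exp (φ.logDist x x t)) x := by
  rw [hasDerivAt_iff_tendsto_slope]
  have h := ((Real.continuous_exp.comp (φ.continuous_logDist x t)).tendsto x).mono_left
    (nhdsWithin_le_nhds (s := {x}ᶜ))
  refine h.congr' ?_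
  filter_upwards [self_mem_nhdsWithin] with y hy
  rw [slope_def_field, flow_sub_flow, mul_div_cancel_left₀ _ (sub_ne_zero.2 hy)]
  rfl

theorem deriv_flow (t x : ℝ) : deriv (φ.flow t) x = Real.exp (φ.logDist x x t) :=
  (φ.hasDerivAt_flow_space t x).deriv

theorem abs_logDist_le {K : ℝ} (hK : ∀ x, |deriv φ x| ≤ K) (x y t : ℝ) :
    |φ.logDist x y t| ≤ K * |t| := by
  have := intervalIntegral.norm_integral_le_of_norm_le_const (a := (0 : ℝ)) (b := t)
    (f := fun s => φ.avgSlope (φ.flow s x) (φ.flow s y)) (C := K)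
    fun s _ => φ.abs_avgSlope_le hK _ _
  simpa [logDist] using this

end SmoothFun

/-! ### Sums over the jumps -/

open Function in
theorem IsLiftFun.leftLim_add_one {F : ℝ → ℝ} (hF : IsLiftFun F) (a : ℝ) :
    leftLim F (a + 1) = leftLim F a + 1 := by
  have h1 := hF.mono.tendsto_leftLim (a + 1)
  have h2 : Tendsto (fun x : ℝ => x + 1) (𝓝[<] a) (𝓝[<] (a + 1)) := by
    refine tendsto_nhdsWithin_of_tendsto_nhds_of_eventually_within _ ?_ ?_
    · exact ((continuous_add_const (1 : ℝ)).tendsto a).mono_left nhdsWithin_le_nhds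
    · filter_upwards [self_mem_nhdsWithin] with x hx
      simpa using hx
  have h3 := h1.comp h2
  have h4 := (hF.mono.tendsto_leftLim a).add_const 1
  refine tendsto_nhds_unique h3 (h4.congr fun x => ?_)
  simp [hF.add_one]

theorem driftTerm_eq_trapErr (φ : SmoothFun) {F : ℝ → ℝ} {a : ℝ} (ha : a ∈ jumpSet F) :
    driftTerm φ F a = φ.trapErr (Function.leftLim F a) (F a) := by
  rw [driftTerm, jumpQuot, SmoothFun.trapErr, φ.avgSlope_eq_div ha.2]

open Function in
-- By monotonicity the intervals `(F(a-), F(a)]` are pairwise disjoint, and those with `a ∈ [0, 1)`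
-- lie in one period of the target line.
theorem sum_integral_jump_le {F f : ℝ → ℝ} (hF : IsLiftFun F) (hf : Continuous f)
    (hp : Function.Periodic f 1) (h0 : ∀ x, 0 ≤ f x) (s : Finset (jumpSet F)) :
    ∑ a ∈ s, ∫ x in leftLim F a..F a, f x ≤ ∫ x in (0 : ℝ)..1, f x := by
  have hle : ∀ a : ℝ, leftLim F a ≤ F a := fun a => hF.mono.leftLim_le le_rfl
  simp_rw [fun a : jumpSet F => intervalIntegral.integral_of_le (f := f) (μ := volume) (hle a)]
  have hd : Set.Pairwise (s : Set (jumpSet F))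
      (Disjoint on fun a : jumpSet F => Ioc (leftLim F a) (F a)) := by
    intro a _ b _ hab
    have key : ∀ a b : jumpSet F, a < b →
        Disjoint (Ioc (leftLim F a) (F a)) (Ioc (leftLim F b) (F b)) := by
      intro a b hab
      rw [Set.disjoint_left]
      intro x hx hx'
      exact absurd (hF.mono.le_leftLim (show (a : ℝ) < b from hab)) (by linarith [hx.2, hx'.1])
    rcases lt_or_gt_of_ne hab with h | h
    · exact key a b h
    · exact (key b a h).symm
  rw [← integral_biUnion_finset s (fun _ _ => measurableSet_Ioc) hd
    fun a _ => hf.integrableOn_Ioc]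
  -- The period starts at `F(0-)` and not at `F(0)`, so that a jump at `0` is covered.
  have h1 := hp.intervalIntegral_add_eq (leftLim F 0) 0
  rw [zero_add] at h1
  rw [← h1, intervalIntegral.integral_of_le (by linarith)]
  refine setIntegral_mono_set hf.integrableOn_Ioc (ae_of_all _ h0) (LE.le.eventuallyLE ?_)
  refine iUnion₂_subset fun a _ => Ioc_subset_Ioc (hF.mono.leftLim a.2.1.1) ?_
  have := hF.mono.le_leftLim a.2.1.2
  have h2 := hF.leftLim_add_one 0
  rw [zero_add] at h2
  linarith

open Function in
theorem summable_jump {F : ℝ → ℝ} (hF : IsLiftFun F) :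
    Summable fun a : jumpSet F => F a - leftLim F a := by
  refine summable_of_sum_le (c := 1) (fun a => sub_nonneg.2 (hF.mono.leftLim_le le_rfl)) fun s => ?_
  have := sum_integral_jump_le (f := fun _ => 1) hF continuous_const (fun _ => rfl)
    (fun _ => zero_le_one) s
  simpa using this

theorem sum_abs_driftTerm_le (φ : SmoothFun) {F : ℝ → ℝ} (hF : IsLiftFun F)
    (s : Finset (jumpSet F)) :
    ∑ a ∈ s, |driftTerm φ F a| ≤ 1 / 2 * ∫ x in (0 : ℝ)..1, |deriv (deriv φ) x| := by
  have hp : Function.Periodic (fun y => |deriv (deriv φ) y|) 1 := fun y => by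
    have := φ.der.der.periodic y
    simp only [SmoothFun.coe_der] at this
    simp [this]
  refine le_trans ?_ (mul_le_mul_of_nonneg_left (sum_integral_jump_le hF
    φ.continuous_deriv_deriv.abs hp (fun _ => abs_nonneg _) s) (by norm_num))
  rw [Finset.mul_sum]
  refine Finset.sum_le_sum fun a _ => ?_
  rw [driftTerm_eq_trapErr φ a.2]
  exact φ.abs_trapErr_le_integral (hF.mono.leftLim_le le_rfl)

theorem summable_abs_driftTerm (φ : SmoothFun) {F : ℝ → ℝ} (hF : IsLiftFun F) :
    Summable fun a : jumpSet F => |driftTerm φ F a| :=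
  summable_of_sum_le (fun _ => abs_nonneg _) (sum_abs_driftTerm_le φ hF)

theorem tsum_abs_driftTerm_le (φ : SmoothFun) {F : ℝ → ℝ} (hF : IsLiftFun F) :
    ∑' a : jumpSet F, |driftTerm φ F a| ≤ 1 / 2 * ∫ x in (0 : ℝ)..1, |deriv (deriv φ) x| :=
  Real.tsum_le_of_sum_le (fun _ => abs_nonneg _) (sum_abs_driftTerm_le φ hF)

theorem abs_tsum_driftTerm_le (φ : SmoothFun) {F : ℝ → ℝ} (hF : IsLiftFun F) :
    |∑' a : jumpSet F, driftTerm φ F a| ≤ ∑' a : jumpSet F, |driftTerm φ F a| := by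
  have := norm_tsum_le_tsum_norm (f := fun a : jumpSet F => driftTerm φ F a)
    (by simpa only [Real.norm_eq_abs] using summable_abs_driftTerm φ hF)
  simpa only [Real.norm_eq_abs] using this

theorem abs_integral_deriv_lift_le (φ : SmoothFun) (F : ℝ → ℝ) :
    |∫ x in (0 : ℝ)..1, deriv φ (F x)| ≤ ∫ x in (0 : ℝ)..1, |deriv (deriv φ) x| := by
  have := intervalIntegral.norm_integral_le_of_norm_le_const (a := (0 : ℝ)) (b := 1)
    (f := fun x => deriv φ (F x)) fun x _ => φ.abs_deriv_le_integral (F x)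
  simpa using this

/-- The drift computed from a lift. -/
def liftDrift (β : ℝ) (φ : ℝ → ℝ) (F : ℝ → ℝ) : ℝ :=
  (∑' a : jumpSet F, driftTerm φ F a) + β * ∫ x in (0 : ℝ)..1, deriv φ (F x)

theorem abs_liftDrift_le {β : ℝ} (hβ : 0 ≤ β) (φ : SmoothFun) {F : ℝ → ℝ} (hF : IsLiftFun F) :
    |liftDrift β φ F| ≤ (1 / 2 + β) * ∫ x in (0 : ℝ)..1, |deriv (deriv φ) x| := by
  have h1 := (abs_tsum_driftTerm_le φ hF).trans (tsum_abs_driftTerm_le φ hF)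
  have h2 := mul_le_mul_of_nonneg_left (abs_integral_deriv_lift_le φ F) hβ
  refine (abs_add_le _ _).trans ?_
  rw [abs_mul, abs_of_nonneg hβ]
  linarith

/-! ### The densities and their derivatives -/

/-- A product of exponentials whose exponents have uniformly summable derivatives can be
differentiated termwise. -/
theorem hasDerivAt_tprod_exp {ι : Type*} {L L' : ι → ℝ → ℝ} {u : ι → ℝ} {ε : ℝ} (hε : 0 < ε)
    (hu : Summable u) (h0 : ∀ i, L i 0 = 0)
    (hL : ∀ i, ∀ t ∈ Metric.ball (0 : ℝ) ε, HasDerivAt (L i) (L' i t) t)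
    (hb : ∀ i, ∀ t ∈ Metric.ball (0 : ℝ) ε, |L' i t| ≤ u i) :
    (∀ t ∈ Metric.ball (0 : ℝ) ε, Multipliable fun i => Real.exp (L i t)) ∧
      HasDerivAt (fun t => ∏' i, Real.exp (L i t)) (∑' i, L' i 0) 0 := by
  have hmem : (0 : ℝ) ∈ Metric.ball (0 : ℝ) ε := Metric.mem_ball_self hε
  have hpre := (convex_ball (0 : ℝ) ε).isPreconnected
  have hs : ∀ t ∈ Metric.ball (0 : ℝ) ε, Summable fun i => L i t := fun t ht =>
    summable_of_summable_hasDerivAt_of_isPreconnected hu Metric.isOpen_ball hpre hL hb hmem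
      (by simp [h0]) ht
  have hd := hasDerivAt_tsum_of_isPreconnected hu Metric.isOpen_ball hpre hL hb hmem
      (hs 0 hmem) hmem
  have hprod : ∀ t ∈ Metric.ball (0 : ℝ) ε,
      HasProd (fun i => Real.exp (L i t)) (Real.exp (∑' i, L i t)) := fun t ht =>
    (hs t ht).hasSum.rexp
  refine ⟨fun t ht => (hprod t ht).multipliable, ?_⟩
  have h2 := hd.exp
  simp only [h0, tsum_zero, Real.exp_zero, one_mul] at h2
  exact h2.congr_of_eventuallyEq (Filter.eventually_of_mem (Metric.ball_mem_nhds 0 hε)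
    fun t ht => (hprod t ht).tprod_eq)

/-- Differentiation of `X^β_h`. -/
theorem hasDerivAt_Xdens {β ε C : ℝ} {h : ℝ → ℝ → ℝ} {κ' : ℝ → ℝ → ℝ} {F : ℝ → ℝ}
    (hF : Monotone F) (hε : 0 < ε) (h0 : ∀ x, deriv (h 0) x = 1) (hm : Measurable (κ' 0))
    (hd : ∀ x, ∀ t ∈ Metric.ball (0 : ℝ) ε,
      HasDerivAt (fun t => Real.log (deriv (h t) x)) (κ' t x) t)
    (hb : ∀ x, ∀ t ∈ Metric.ball (0 : ℝ) ε, |κ' t x| ≤ C) :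
    HasDerivAt (fun t => Xdens β (h t) F) (β * ∫ s in (0 : ℝ)..1, κ' 0 (F s)) 0 := by
  have hFm : Measurable F := hF.measurable
  have key := (intervalIntegral.hasDerivAt_integral_of_dominated_loc_of_deriv_le
    (μ := volume) (a := 0) (b := 1) (F := fun t s => Real.log (deriv (h t) (F s)))
    (F' := fun t s => κ' t (F s)) (x₀ := 0) (bound := fun _ => C)
    (Metric.ball_mem_nhds 0 hε)
    (Eventually.of_forall fun t =>
      (Real.measurable_log.comp ((measurable_deriv (h t)).comp hFm)).aestronglyMeasurable)
    (by simp [h0]) (hm.comp hFm).aestronglyMeasurable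
    (ae_of_all _ fun s _ t ht => hb (F s) t ht) (by simp)
    (ae_of_all _ fun s _ t ht => hd (F s) t ht)).2
  have h2 := (key.const_mul β).exp
  simpa [h0, Xdens] using h2

namespace SmoothFun

variable (φ : SmoothFun)

/-- Derivatives and difference quotient alike are distortions of a segment, degenerate for the
former; the time derivative of the exponent is a trapezoid error at the transported end points. -/
theorem jumpFactor_flow {F : ℝ → ℝ} {a : ℝ} (ha : a ∈ jumpSet F) (t : ℝ) :
    jumpFactor (φ.flow t) F a = Real.exp
      ((φ.logDist (Function.leftLim F a) (Function.leftLim F a) t + φ.logDist (F a) (F a) t) / 2 -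
        φ.logDist (Function.leftLim F a) (F a) t) := by
  rw [jumpFactor, jumpQuot, deriv_flow, deriv_flow, flow_sub_flow,
    mul_div_cancel_left₀ _ (sub_ne_zero.2 (Ne.symm ha.2)), ← Real.exp_add, ← Real.exp_half,
    ← Real.exp_sub]

theorem tprod_jumpFactor_flow {F : ℝ → ℝ} (hF : IsLiftFun F) :
    (∀ t : ℝ, Multipliable fun a : jumpSet F => jumpFactor (φ.flow t) F a) ∧
      HasDerivAt (fun t => Y0 (φ.flow t) F) (∑' a : jumpSet F, driftTerm φ F a) 0 := by
  obtain ⟨K, hK0, hK⟩ := φ.der.exists_abs_le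
  obtain ⟨C, hC0, hC⟩ := φ.exists_abs_trapErr_le
  -- The radius stays free: `R = |t| + 1` gives convergence at every time, `R = 1` the derivative at
  -- zero. Up to time `R` a jump is stretched by at most `exp (K * R)`, which gives the summable
  -- bound.
  have key : ∀ R : ℝ, 0 < R → _ := fun R hR => hasDerivAt_tprod_exp (ι := jumpSet F) (ε := R)
    (L := fun a t => (φ.logDist (Function.leftLim F a) (Function.leftLim F a) t +
      φ.logDist (F a) (F a) t) / 2 - φ.logDist (Function.leftLim F a) (F a) t)
    (L' := fun a t => φ.trapErr (φ.flow t (Function.leftLim F a)) (φ.flow t (F a)))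
    (u := fun a => C * Real.exp (K * R) * (F a - Function.leftLim F a)) hR
    ((summable_jump hF).mul_left _) (fun a => by simp)
    (fun a t _ => by
      refine ((((φ.hasDerivAt_logDist _ _ t).add (φ.hasDerivAt_logDist _ _ t)).div_const 2).sub
        (φ.hasDerivAt_logDist _ _ t)).congr_deriv ?_
      rw [avgSlope_self, avgSlope_self, trapErr]; ring)
    (fun a t ht => by
      have hle := hF.mono.leftLim_le (le_refl (a : ℝ))
      refine (hC _ _ ((φ.flow_strictMono t).monotone hle)).1.trans ?_
      rw [flow_sub_flow, mul_assoc, mul_comm (Real.exp _)]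
      refine mul_le_mul_of_nonneg_left (mul_le_mul_of_nonneg_left (Real.exp_le_exp.2 ?_)
        (sub_nonneg.2 hle)) hC0
      refine (le_abs_self _).trans ((φ.abs_logDist_le hK _ _ t).trans ?_)
      rw [mem_ball_zero_iff] at ht
      exact mul_le_mul_of_nonneg_left ht.le hK0)
  have hfac : ∀ t, (fun a : jumpSet F => jumpFactor (φ.flow t) F a) = _ := fun t =>
    funext fun a => φ.jumpFactor_flow a.2 t
  constructor
  · intro t
    rw [hfac]
    exact (key (|t| + 1) (by positivity)).1 t (by simp)
  · have h2 := (key 1 one_pos).2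
    simp only [flow_zero] at h2
    simp only [Y0, hfac]
    refine h2.congr_deriv ?_
    exact tsum_congr fun a => (driftTerm_eq_trapErr φ a.2).symm

theorem hasDerivAt_Ydens_flow {F : ℝ → ℝ} (hF : IsLiftFun F) (β : ℝ) :
    HasDerivAt (fun t : ℝ => Ydens β (φ.flow t) F) (liftDrift β φ F) 0 := by
  obtain ⟨K, hK0, hK⟩ := φ.der.exists_abs_le
  have h1 := hasDerivAt_Xdens (β := β) (h := φ.flow) (κ' := fun t x => deriv φ (φ.flow t x))
    (C := K) hF.mono one_pos (fun x => by simp [deriv_flow])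
    (φ.continuous_deriv.comp (φ.continuous_flow 0)).measurable
    (fun x t _ => by
      simp only [deriv_flow, Real.log_exp]
      simpa using φ.hasDerivAt_logDist x x t)
    (fun x t _ => hK _)
  simp only [flow_zero] at h1
  have h2 := (φ.tprod_jumpFactor_flow hF).2
  refine (h1.mul h2).congr_deriv ?_
  have h3 : Y0 (φ.flow 0) F = 1 := by
    simp only [Y0]
    rw [tprod_congr fun a : jumpSet F => φ.jumpFactor_flow a.2 0]
    simp
  have h4 : Xdens β (φ.flow 0) F = 1 := by simp [Xdens, deriv_flow]
  rw [h3, h4, liftDrift]; ring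

/-- The average slope is a value of `φ'` inside the segment, by the mean value theorem, and `φ'` is
Lipschitz. -/
theorem abs_sub_avgSlope_le : ∃ C : ℝ, 0 ≤ C ∧ ∀ a b, a ≤ b →
    |deriv φ a - φ.avgSlope a b| ≤ C * (b - a) ∧ |deriv φ b - φ.avgSlope a b| ≤ C * (b - a) := by
  obtain ⟨C, hC0, hC⟩ := φ.der.exists_abs_sub_le
  refine ⟨C, hC0, fun a b h => ?_⟩
  rcases h.eq_or_lt with rfl | h
  · simp
  obtain ⟨c, hc, hc'⟩ := exists_deriv_eq_slope φ h φ.continuous.continuousOn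
    (fun x _ => (φ.hasDerivAt x).differentiableAt.differentiableWithinAt)
  rw [φ.avgSlope_eq_div h.ne, ← hc']
  constructor
  · refine (hC a c).trans (mul_le_mul_of_nonneg_left ?_ hC0)
    rw [abs_sub_comm, abs_of_pos (sub_pos.2 hc.1)]; linarith [hc.2]
  · refine (hC b c).trans (mul_le_mul_of_nonneg_left ?_ hC0)
    rw [abs_of_pos (sub_pos.2 hc.2)]; linarith [hc.1]

theorem deriv_perturb (t x : ℝ) : deriv (fun x => x + t * φ x) x = 1 + t * deriv φ x :=
  ((hasDerivAt_id x).add ((φ.hasDerivAt x).const_mul t)).deriv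

/-- The condition `ht` ranges over all `v` dominated by every bound of `|φ'|`, so that it covers
both end point derivatives and the average slope at once. -/
theorem jumpFactor_perturb {F : ℝ → ℝ} {a : ℝ} (ha : a ∈ jumpSet F) {t : ℝ}
    (ht : ∀ v, (∀ K, (∀ x, |deriv φ x| ≤ K) → |v| ≤ K) → 0 < 1 + t * v) :
    jumpFactor (fun x => x + t * φ x) F a = Real.exp
      ((Real.log (1 + t * deriv φ (Function.leftLim F a)) + Real.log (1 + t * deriv φ (F a))) / 2 -
        Real.log (1 + t * φ.avgSlope (Function.leftLim F a) (F a))) := by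
  have h1 := ht (deriv φ (Function.leftLim F a)) fun K hK => hK _
  have h2 := ht (deriv φ (F a)) fun K hK => hK _
  have h3 := ht (φ.avgSlope (Function.leftLim F a) (F a)) fun K hK => φ.abs_avgSlope_le hK _ _
  have hne := sub_ne_zero.2 (Ne.symm ha.2)
  rw [jumpFactor, jumpQuot, deriv_perturb, deriv_perturb, Real.exp_sub, Real.exp_log h3,
    ← Real.log_mul h1.ne' h2.ne', Real.exp_half, Real.exp_log (mul_pos h1 h2)]
  congr 1
  rw [div_eq_iff hne]
  linear_combination -t * φ.mul_avgSlope (Function.leftLim F a) (F a)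

theorem hasDerivAt_log_one_add {t v : ℝ} (h : 0 < 1 + t * v) :
    HasDerivAt (fun t => Real.log (1 + t * v)) (v / (1 + t * v)) t := by
  have : HasDerivAt (fun t => 1 + t * v) v t := by
    simpa using ((hasDerivAt_id t).mul_const v).const_add 1
  exact this.log h.ne'

/-- The difference is `(v - w) / ((1 + t * v) * (1 + t * w))`, with both factors of the denominator
at least `1 / 2`. -/
theorem abs_div_sub_div_le {t v w : ℝ} (hv : 1 / 2 ≤ 1 + t * v) (hw : 1 / 2 ≤ 1 + t * w) :
    |v / (1 + t * v) - w / (1 + t * w)| ≤ 4 * |v - w| := by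
  have h1 : 0 < 1 + t * v := by linarith
  have h2 : 0 < 1 + t * w := by linarith
  have h3 : v / (1 + t * v) - w / (1 + t * w) = (v - w) / ((1 + t * v) * (1 + t * w)) := by
    rw [div_sub_div _ _ h1.ne' h2.ne']; congr 1; ring
  rw [h3, abs_div, abs_of_pos (mul_pos h1 h2), div_le_iff₀ (mul_pos h1 h2)]
  nlinarith [abs_nonneg (v - w), mul_le_mul hv hw (by norm_num) h1.le]

theorem exists_perturb_bound : ∃ ε K : ℝ, 0 < ε ∧ (∀ x, |deriv φ x| ≤ K) ∧
    ∀ t ∈ Metric.ball (0 : ℝ) ε, ∀ v, |v| ≤ K → 1 / 2 ≤ 1 + t * v := by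
  obtain ⟨K, hK0, hK⟩ := φ.der.exists_abs_le
  -- This radius forces `|t * v| < 1 / 2`; the `+ 1` covers `K = 0`.
  refine ⟨1 / (2 * (K + 1)), K, by positivity, hK, fun t ht v hv => ?_⟩
  rw [mem_ball_zero_iff, Real.norm_eq_abs, lt_div_iff₀ (by positivity)] at ht
  have h1 : |t * v| ≤ |t| * (K + 1) := by
    rw [abs_mul]; exact mul_le_mul_of_nonneg_left (by linarith) (abs_nonneg t)
  have := (abs_le.1 h1).1
  linarith

theorem tprod_jumpFactor_perturb {F : ℝ → ℝ} (hF : IsLiftFun F) :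
    (∀ᶠ t : ℝ in 𝓝 0, Multipliable fun a : jumpSet F => jumpFactor (fun x => x + t * φ x) F a) ∧
      HasDerivAt (fun t : ℝ => Y0 (fun x => x + t * φ x) F)
        (∑' a : jumpSet F, driftTerm φ F a) 0 := by
  obtain ⟨ε, K, hε, hK, hpos⟩ := φ.exists_perturb_bound
  obtain ⟨C, hC0, hC⟩ := φ.abs_sub_avgSlope_le
  have hp : ∀ t ∈ Metric.ball (0 : ℝ) ε, ∀ v, |v| ≤ K → 0 < 1 + t * v := fun t ht v hv => by
    linarith [hpos t ht v hv]
  have key := hasDerivAt_tprod_exp (ι := jumpSet F) (ε := ε)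
    (L := fun a t => (Real.log (1 + t * deriv φ (Function.leftLim F a)) +
      Real.log (1 + t * deriv φ (F a))) / 2 -
        Real.log (1 + t * φ.avgSlope (Function.leftLim F a) (F a)))
    (L' := fun a t => (deriv φ (Function.leftLim F a) / (1 + t * deriv φ (Function.leftLim F a)) +
      deriv φ (F a) / (1 + t * deriv φ (F a))) / 2 -
        φ.avgSlope (Function.leftLim F a) (F a) /
          (1 + t * φ.avgSlope (Function.leftLim F a) (F a)))
    -- Both end point terms are compared with the average slope term, each at cost `4 * C` times the
    -- jump; the mean of the two costs the same.
    (u := fun a => 4 * C * (F a - Function.leftLim F a)) hε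
    ((summable_jump hF).mul_left _) (fun a => by simp)
    (fun a t ht => (((hasDerivAt_log_one_add (hp t ht _ (hK _))).add
      (hasDerivAt_log_one_add (hp t ht _ (hK _)))).div_const 2).sub
        (hasDerivAt_log_one_add (hp t ht _ (φ.abs_avgSlope_le hK _ _))))
    (fun a t ht => by
      have hle := hF.mono.leftLim_le (le_refl (a : ℝ))
      have hs := hpos t ht _ (φ.abs_avgSlope_le hK (Function.leftLim F a) (F a))
      have h1 := (abs_div_sub_div_le (hpos t ht _ (hK (Function.leftLim F a))) hs).trans
        (mul_le_mul_of_nonneg_left (hC _ _ hle).1 (by norm_num))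
      have h2 := (abs_div_sub_div_le (hpos t ht _ (hK (F a))) hs).trans
        (mul_le_mul_of_nonneg_left (hC _ _ hle).2 (by norm_num))
      rw [abs_le] at h1 h2 ⊢
      constructor <;> linarith [h1.1, h1.2, h2.1, h2.2])
  have hfac : ∀ t ∈ Metric.ball (0 : ℝ) ε,
      (fun a : jumpSet F => jumpFactor (fun x => x + t * φ x) F a) = _ := fun t ht =>
    funext fun a => φ.jumpFactor_perturb a.2 fun v hv => hp t ht v (hv K hK)
  have hball := Metric.ball_mem_nhds (0 : ℝ) hε
  constructor
  · filter_upwards [hball] with t ht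
    rw [hfac t ht]
    exact key.1 t ht
  · refine (key.2.congr_of_eventuallyEq ?_).congr_deriv ?_
    · filter_upwards [hball] with t ht
      rw [Y0, hfac t ht]
    · refine tsum_congr fun a => ?_
      rw [driftTerm_eq_trapErr φ a.2, trapErr]
      simp; ring

theorem hasDerivAt_Ydens_perturb {F : ℝ → ℝ} (hF : IsLiftFun F) (β : ℝ) :
    HasDerivAt (fun t : ℝ => Ydens β (fun x => x + t * φ x) F) (liftDrift β φ F) 0 := by
  obtain ⟨ε, K, hε, hK, hpos⟩ := φ.exists_perturb_bound
  have hp : ∀ t ∈ Metric.ball (0 : ℝ) ε, ∀ x, 1 / 2 ≤ 1 + t * deriv φ x := fun t ht x =>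
    hpos t ht _ (hK x)
  have h1 := hasDerivAt_Xdens (β := β) (h := fun t x => x + t * φ x)
    (κ' := fun t x => deriv φ x / (1 + t * deriv φ x))
    (C := 2 * K) hF.mono hε (fun x => by rw [deriv_perturb]; simp)
    (by simpa using φ.continuous_deriv.measurable)
    (fun x t ht => by
      simp only [deriv_perturb]
      exact hasDerivAt_log_one_add (by linarith [hp t ht x]))
    (fun x t ht => by
      have h := hp t ht x
      rw [abs_div, abs_of_pos (by linarith : 0 < 1 + t * deriv φ x), div_le_iff₀ (by linarith)]
      nlinarith [hK x, abs_nonneg (deriv φ x)])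
  have h2 := (φ.tprod_jumpFactor_perturb hF).2
  refine (h1.mul h2).congr_deriv ?_
  have h3 : Y0 (fun x => x + 0 * φ x) F = 1 := by
    simp only [Y0]
    rw [tprod_congr fun a : jumpSet F => φ.jumpFactor_perturb a.2 (t := 0) (by simp)]
    simp
  have h4 : Xdens β (fun x => x + 0 * φ x) F = 1 := by simp [Xdens]
  rw [h3, h4, liftDrift]; simp; ring

end SmoothFun

/-! ### Riemann sums over the cells of a regular partition -/

/-- These are the end points of the half-open cell containing `x`. The left one is strictly below
`x`, so a lift converges along it to its left limit; along the right one right continuity applies.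
-/
theorem tendsto_ceil_mul_div (x : ℝ) :
    Tendsto (fun N : ℕ => (⌈(N : ℝ) * x⌉ : ℝ) / N) atTop (𝓝[≥] x) ∧
      Tendsto (fun N : ℕ => ((⌈(N : ℝ) * x⌉ : ℝ) - 1) / N) atTop (𝓝[<] x) := by
  have h0 : Tendsto (fun N : ℕ => (1 : ℝ) / N) atTop (𝓝 0) := tendsto_one_div_atTop_nhds_zero_nat
  have hpos : ∀ᶠ N : ℕ in atTop, (0 : ℝ) < N := by
    filter_upwards [eventually_gt_atTop 0] with N hN
    exact_mod_cast hN
  have hA : ∀ᶠ N : ℕ in atTop, x ≤ (⌈(N : ℝ) * x⌉ : ℝ) / N ∧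
      (⌈(N : ℝ) * x⌉ : ℝ) / N ≤ x + 1 / N := by
    filter_upwards [hpos] with N hN
    rw [le_div_iff₀ hN, div_le_iff₀ hN, add_mul, one_div_mul_cancel hN.ne']
    constructor
    · linarith [Int.le_ceil ((N : ℝ) * x)]
    · linarith [Int.ceil_lt_add_one ((N : ℝ) * x)]
  have hB : ∀ᶠ N : ℕ in atTop, x - 1 / N ≤ ((⌈(N : ℝ) * x⌉ : ℝ) - 1) / N ∧
      ((⌈(N : ℝ) * x⌉ : ℝ) - 1) / N < x := by
    filter_upwards [hpos] with N hN
    rw [le_div_iff₀ hN, div_lt_iff₀ hN, sub_mul, one_div_mul_cancel hN.ne']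
    constructor
    · linarith [Int.le_ceil ((N : ℝ) * x)]
    · linarith [Int.ceil_lt_add_one ((N : ℝ) * x)]
  constructor
  · refine tendsto_nhdsWithin_of_tendsto_nhds_of_eventually_within _ ?_ (hA.mono fun N h => h.1)
    exact tendsto_of_tendsto_of_tendsto_of_le_of_le' tendsto_const_nhds
      (by simpa using h0.const_add x) (hA.mono fun N h => h.1) (hA.mono fun N h => h.2)
  · refine tendsto_nhdsWithin_of_tendsto_nhds_of_eventually_within _ ?_ (hB.mono fun N h => h.2)
    exact tendsto_of_tendsto_of_tendsto_of_le_of_le' (by simpa using h0.const_sub x)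
      tendsto_const_nhds (hB.mono fun N h => h.1) (hB.mono fun N h => h.2.le)

/-- Riemann–Stieltjes sums of a function of the increments of a lift converge to the integral of
the corresponding function of the jumps. -/
theorem tendsto_sum_cells {F : ℝ → ℝ} (hF : IsLiftFun F) (μ : Measure ℝ)
    [IsLocallyFiniteMeasure μ] {S : ℝ → ℝ → ℝ} {C : ℝ}
    (hm : Measurable fun p : ℝ × ℝ => S p.1 p.2) (hb : ∀ a b, a ≤ b → |S a b| ≤ C)
    (hc : ∀ (a b : ℝ) (u v : ℕ → ℝ), Tendsto u atTop (𝓝 a) → Tendsto v atTop (𝓝 b) →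
      (∀ n, u n ≤ v n) → Tendsto (fun n => S (u n) (v n)) atTop (𝓝 (S a b))) :
    Tendsto (fun N : ℕ => ∑ i ∈ Finset.range N,
      μ.real (Ioc ((i : ℝ) / N) (((i + 1 : ℕ) : ℝ) / N)) *
        S (F ((i : ℝ) / N)) (F (((i + 1 : ℕ) : ℝ) / N)))
      atTop (𝓝 (∫ x in Ioc (0 : ℝ) 1, S (Function.leftLim F x) (F x) ∂μ)) := by
  have hFm : Measurable F := hF.mono.measurable
  -- A step function constant on each cell, so its integral over `(0, 1]` is the sum in question,
  -- and dominated convergence yields the limit.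
  set f : ℕ → ℝ → ℝ := fun N x =>
    S (F (((⌈(N : ℝ) * x⌉ : ℝ) - 1) / N)) (F ((⌈(N : ℝ) * x⌉ : ℝ) / N)) with hf
  have hfm : ∀ N, Measurable (f N) := by
    intro N
    refine hm.comp (Measurable.prodMk (hFm.comp ?_) (hFm.comp ?_))
    · have : Measurable fun x : ℝ => (⌈(N : ℝ) * x⌉ : ℝ) :=
        measurable_from_top.comp (Int.measurable_ceil.comp (measurable_const_mul _))
      fun_prop
    · have : Measurable fun x : ℝ => (⌈(N : ℝ) * x⌉ : ℝ) :=
        measurable_from_top.comp (Int.measurable_ceil.comp (measurable_const_mul _))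
      fun_prop
  have hle : ∀ (N : ℕ) (x : ℝ),
      F (((⌈(N : ℝ) * x⌉ : ℝ) - 1) / N) ≤ F ((⌈(N : ℝ) * x⌉ : ℝ) / N) := fun N x =>
    hF.mono (div_le_div_of_nonneg_right (by linarith) N.cast_nonneg)
  have hfb : ∀ N x, ‖f N x‖ ≤ C := fun N x => hb _ _ (hle N x)
  have hint : ∀ N a b, IntervalIntegrable (f N) μ a b := fun N a b =>
    ⟨Measure.integrableOn_of_bounded measure_Ioc_lt_top.ne (hfm N).aestronglyMeasurable
      (ae_of_all _ (hfb N)), Measure.integrableOn_of_bounded measure_Ioc_lt_top.ne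
      (hfm N).aestronglyMeasurable (ae_of_all _ (hfb N))⟩
  have hlim : Tendsto (fun N : ℕ => ∫ x in Ioc (0 : ℝ) 1, f N x ∂μ) atTop
      (𝓝 (∫ x in Ioc (0 : ℝ) 1, S (Function.leftLim F x) (F x) ∂μ)) := by
    refine tendsto_integral_of_dominated_convergence (fun _ => C)
      (fun N => (hfm N).aestronglyMeasurable)
      (integrableOn_const measure_Ioc_lt_top.ne) (fun N => ae_of_all _ (hfb N))
      (ae_of_all _ fun x => ?_)
    refine hc _ _ _ _ ?_ ?_ fun N => hle N x
    · exact (hF.mono.tendsto_leftLim x).comp (tendsto_ceil_mul_div x).2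
    · exact Tendsto.comp (hF.rightCont x) (tendsto_ceil_mul_div x).1
  refine hlim.congr' ?_
  filter_upwards [eventually_gt_atTop 0] with N hN
  have hN' : (0 : ℝ) < N := by exact_mod_cast hN
  have h1 := intervalIntegral.sum_integral_adjacent_intervals (μ := μ) (f := f N)
    (a := fun i : ℕ => (i : ℝ) / N) (n := N) fun k _ => hint N _ _
  simp only [CharP.cast_eq_zero, zero_div, div_self hN'.ne'] at h1
  rw [← intervalIntegral.integral_of_le zero_le_one, ← h1]
  refine Finset.sum_congr rfl fun i _ => ?_
  rw [intervalIntegral.integral_of_le (div_le_div_of_nonneg_right (by simp) hN'.le),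
    setIntegral_congr_fun measurableSet_Ioc (g := fun _ =>
      S (F ((i : ℝ) / N)) (F (((i + 1 : ℕ) : ℝ) / N))), setIntegral_const, smul_eq_mul]
  intro x hx
  have : ⌈(N : ℝ) * x⌉ = (i : ℤ) + 1 := by
    rw [Int.ceil_eq_iff]
    have h2 := hx.1
    have h3 := hx.2
    rw [div_lt_iff₀ hN'] at h2
    rw [le_div_iff₀ hN'] at h3
    push_cast at h3 ⊢
    constructor <;> linarith
  simp only [hf, this]
  push_cast
  simp

/-- The sum over the cells of the regular partition of the trapezoid errors. -/
def cellSum (φ : SmoothFun) (F : ℝ → ℝ) (N : ℕ) : ℝ :=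
  ∑ i ∈ Finset.range N, φ.trapErr (F ((i : ℝ) / N)) (F (((i + 1 : ℕ) : ℝ) / N))

/-- The mean over the cells of the regular partition of the difference quotients. -/
def cellMean (φ : SmoothFun) (F : ℝ → ℝ) (N : ℕ) : ℝ :=
  ∑ i ∈ Finset.range N, 1 / (N : ℝ) * φ.avgSlope (F ((i : ℝ) / N)) (F (((i + 1 : ℕ) : ℝ) / N))

/-- A lift as a Stieltjes function. -/
def IsLiftFun.stieltjes {F : ℝ → ℝ} (hF : IsLiftFun F) : StieltjesFunction ℝ :=
  ⟨F, hF.mono, hF.rightCont⟩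

@[simp] theorem IsLiftFun.coe_stieltjes {F : ℝ → ℝ} (hF : IsLiftFun F) :
    (hF.stieltjes : ℝ → ℝ) = F := rfl

theorem IsLiftFun.real_measure_Ioc {F : ℝ → ℝ} (hF : IsLiftFun F) {a b : ℝ} (h : a ≤ b) :
    hF.stieltjes.measure.real (Ioc a b) = F b - F a := by
  rw [measureReal_def, StieltjesFunction.measure_Ioc,
    ENNReal.toReal_ofReal (sub_nonneg.2 (hF.stieltjes.mono h)), hF.coe_stieltjes]

theorem IsLiftFun.real_measure_singleton {F : ℝ → ℝ} (hF : IsLiftFun F) (a : ℝ) :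
    hF.stieltjes.measure.real {a} = F a - Function.leftLim F a := by
  rw [measureReal_def, StieltjesFunction.measure_singleton,
    ENNReal.toReal_ofReal (sub_nonneg.2 (hF.stieltjes.mono.leftLim_le le_rfl)), hF.coe_stieltjes]

theorem IsLiftFun.countable_leftLim_ne {F : ℝ → ℝ} (hF : IsLiftFun F) :
    {x | Function.leftLim F x ≠ F x}.Countable :=
  hF.stieltjes.countable_leftLim_ne

/-- Lebesgue measure does not see the countably many jumps, and elsewhere the limiting slope is
`avgSlope (F x) (F x) = φ'(F x)`. -/
theorem tendsto_cellMean (φ : SmoothFun) {F : ℝ → ℝ} (hF : IsLiftFun F) :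
    Tendsto (cellMean φ F) atTop (𝓝 (∫ x in (0 : ℝ)..1, deriv φ (F x))) := by
  obtain ⟨K, -, hK⟩ := φ.der.exists_abs_le
  have h := tendsto_sum_cells hF volume (S := φ.avgSlope) φ.continuous_avgSlope.measurable
    (fun a b _ => φ.abs_avgSlope_le hK a b) (fun a b u v hu hv _ =>
      (φ.continuous_avgSlope.tendsto (a, b)).comp (hu.prodMk_nhds hv))
  have h1 : ∫ x in (0 : ℝ)..1, deriv φ (F x) =
      ∫ x in Ioc (0 : ℝ) 1, φ.avgSlope (Function.leftLim F x) (F x) := by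
    rw [intervalIntegral.integral_of_le zero_le_one]
    refine integral_congr_ae (ae_restrict_of_ae ?_)
    have : ∀ᵐ x : ℝ, x ∉ {x | Function.leftLim F x ≠ F x} :=
      measure_eq_zero_iff_ae_notMem.1 (hF.countable_leftLim_ne.measure_zero volume)
    filter_upwards [this] with x hx
    have hx' : Function.leftLim F x = F x := by simpa using hx
    rw [hx', φ.avgSlope_self]
  rw [h1]
  refine h.congr fun N => Finset.sum_congr rfl fun i _ => ?_
  rw [measureReal_def, Real.volume_Ioc, ENNReal.toReal_ofReal]
  · push_cast; ring
  · rw [← sub_div]; exact div_nonneg (by simp) N.cast_nonneg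

/-- Weighting `S = trapErr / (b - a)` by the increments of `F` restores the trapezoid errors. In the
limit `S` is integrated against `dF` and vanishes where `F` is continuous, so only the atoms
contribute. -/
theorem tendsto_cellSum (φ : SmoothFun) {F : ℝ → ℝ} (hF : IsLiftFun F) :
    Tendsto (cellSum φ F) atTop (𝓝 (∑' a : jumpSet F, driftTerm φ F a)) := by
  obtain ⟨C, hC0, hC⟩ := φ.exists_abs_trapErr_le
  -- On the diagonal the convention `0 / 0 = 0` agrees with the continuous extension provided by the
  -- quadratic bound.
  set S : ℝ → ℝ → ℝ := fun a b => φ.trapErr a b / (b - a) with hS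
  have hSm : Measurable fun p : ℝ × ℝ => S p.1 p.2 :=
    φ.continuous_trapErr.measurable.div (measurable_snd.sub measurable_fst)
  have hb : ∀ a b, a ≤ b → |S a b| ≤ C ∧ |S a b| ≤ C * (b - a) := by
    intro a b h
    rcases h.eq_or_lt with rfl | h
    · simp [hS, hC0]
    · have h1 := sub_pos.2 h
      obtain ⟨h2, h3⟩ := hC a b h.le
      rw [hS]
      simp only [abs_div, abs_of_pos h1]
      rw [div_le_iff₀ h1, div_le_iff₀ h1]
      exact ⟨h2, h3.trans (by rw [sq, mul_assoc])⟩
  have hSc : ∀ (a b : ℝ) (u v : ℕ → ℝ), Tendsto u atTop (𝓝 a) → Tendsto v atTop (𝓝 b) →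
      (∀ n, u n ≤ v n) → Tendsto (fun n => S (u n) (v n)) atTop (𝓝 (S a b)) := by
    intro a b u v hu hv huv
    by_cases hab : a = b
    · subst hab
      have h1 : Tendsto (fun n => C * (v n - u n)) atTop (𝓝 0) := by
        simpa using (hv.sub hu).const_mul C
      simpa [hS] using squeeze_zero_norm (fun n => (hb _ _ (huv n)).2) h1
    · exact ((φ.continuous_trapErr.tendsto (a, b)).comp (hu.prodMk_nhds hv)).div (hv.sub hu)
        (sub_ne_zero.2 (Ne.symm hab))
  have hmul : ∀ a b, (b - a) * S a b = φ.trapErr a b := by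
    intro a b
    by_cases hab : a = b
    · subst hab; simp
    · rw [hS]; exact mul_div_cancel₀ _ (sub_ne_zero.2 (Ne.symm hab))
  set μ := hF.stieltjes.measure with hμ
  have hlim := tendsto_sum_cells hF μ hSm (fun a b h => (hb a b h).1) hSc
  set s : ℝ → ℝ := fun x => S (Function.leftLim F x) (F x) with hs
  have hsm : Measurable s :=
    hSm.comp (hF.mono.leftLim.measurable.prodMk hF.mono.measurable)
  have hsb : ∀ x, ‖s x‖ ≤ C := fun x => (hb _ _ (hF.mono.leftLim_le le_rfl)).1
  have hint : ∀ t : Set ℝ, μ t ≠ ⊤ → IntegrableOn s t μ := fun t ht =>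
    Measure.integrableOn_of_bounded ht hsm.aestronglyMeasurable (ae_of_all _ hsb)
  have hIoo : IntegrableOn s (Ioo 0 1) μ := hint _ measure_Ioo_lt_top.ne
  have hone : ∀ x : ℝ, ∫ y in {x}, s y ∂μ = φ.trapErr (Function.leftLim F x) (F x) := by
    intro x
    rw [integral_singleton, hF.real_measure_singleton, smul_eq_mul, hmul]
  have h01 : φ.trapErr (Function.leftLim F 1) (F 1) =
      φ.trapErr (Function.leftLim F 0) (F 0) := by
    have h2 := hF.leftLim_add_one 0
    have h3 := hF.add_one 0
    have h4 := φ.trapErr_add_int (Function.leftLim F 0) (F 0) 1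
    rw [zero_add] at h2 h3
    rw [h2, h3]
    exact_mod_cast h4
  -- The cells fill `(0, 1]` while `jumpSet` lies in `[0, 1)`; by periodicity the atoms at `0` and
  -- `1` contribute equally.
  have hshift : ∫ x in Ioc (0 : ℝ) 1, s x ∂μ = ∫ x in Ico (0 : ℝ) 1, s x ∂μ := by
    rw [← Ioo_union_right (zero_lt_one' ℝ), ← Ioo_union_left (zero_lt_one' ℝ),
      setIntegral_union (by simp) (measurableSet_singleton _) hIoo
        (hint _ (by simp [hμ])),
      setIntegral_union (by simp) (measurableSet_singleton _) hIoo
        (hint _ (by simp [hμ])), hone, hone, h01]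
  have hJ : ∫ x in Ico (0 : ℝ) 1, s x ∂μ = ∑' a : jumpSet F, driftTerm φ F a := by
    rw [setIntegral_eq_of_subset_of_forall_sdiff_eq_zero (s := jumpSet F) measurableSet_Ico
      (fun x hx => hx.1), setIntegral_countable]
    · refine tsum_congr fun a => ?_
      rw [driftTerm_eq_trapErr φ a.2, hF.real_measure_singleton, smul_eq_mul, hmul]
    · exact hF.countable_leftLim_ne.mono fun x hx => hx.2
    · exact (hint (Ico 0 1) measure_Ico_lt_top.ne).mono_set fun x hx => hx.1
    · intro x hx
      have hx' : Function.leftLim F x = F x := by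
        by_contra hne
        exact hx.2 ⟨hx.1, hne⟩
      simp [hs, hS, hx']
  rw [← hJ, ← hshift]
  refine hlim.congr fun N => Finset.sum_congr rfl fun i _ => ?_
  rw [hF.real_measure_Ioc (div_le_div_of_nonneg_right (by simp) N.cast_nonneg), hmul]

/-! ### Independence of the lift -/

theorem lift_eq_add_int {F F' : ℝ → ℝ} {g : G} (hF : IsLift F g) (hF' : IsLift F' g) (x : ℝ) :
    ∃ n : ℤ, F x = F' x + n := by
  rw [← coe_eq_coe_iff, ← inducedMap_coe hF.1, ← inducedMap_coe hF'.1, hF.2, hF'.2]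

theorem IsLiftFun.sum_cells {F : ℝ → ℝ} (hF : IsLiftFun F) {N : ℕ} (hN : 0 < N) :
    ∑ i ∈ Finset.range N, (F (((i + 1 : ℕ) : ℝ) / N) - F ((i : ℝ) / N)) = 1 := by
  have hN' : (N : ℝ) ≠ 0 := by exact_mod_cast hN.ne'
  rw [Finset.sum_range_sub fun i : ℕ => F ((i : ℝ) / N)]
  have := hF.add_one 0
  rw [zero_add] at this
  simp [div_self hN', this]

theorem IsLiftFun.cell_nonneg {F : ℝ → ℝ} (hF : IsLiftFun F) (N i : ℕ) :
    0 ≤ F (((i + 1 : ℕ) : ℝ) / N) - F ((i : ℝ) / N) :=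
  sub_nonneg.2 (hF.mono (div_le_div_of_nonneg_right (by simp) N.cast_nonneg))

theorem IsLiftFun.cell_eq_zero {F : ℝ → ℝ} (hF : IsLiftFun F) {N j i : ℕ} (hj : j < N)
    (h : F (((j + 1 : ℕ) : ℝ) / N) - F ((j : ℝ) / N) = 1) (hi : i < N) (hij : i ≠ j) :
    F (((i + 1 : ℕ) : ℝ) / N) = F ((i : ℝ) / N) := by
  have h1 := hF.sum_cells (Nat.zero_lt_of_lt hj)
  rw [← Finset.add_sum_erase _ _ (Finset.mem_range.2 hj), h] at h1
  have h2 := (Finset.sum_eq_zero_iff_of_nonneg fun i _ => hF.cell_nonneg N i).1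
    (by linarith : ∑ i ∈ (Finset.range N).erase j,
      (F (((i + 1 : ℕ) : ℝ) / N) - F ((i : ℝ) / N)) = 0) i
    (Finset.mem_erase.2 ⟨hij, Finset.mem_range.2 hi⟩)
  linarith

theorem cellSum_of_cell_eq_one (φ : SmoothFun) {F : ℝ → ℝ} (hF : IsLiftFun F) {N j : ℕ}
    (hj : j < N) (h : F (((j + 1 : ℕ) : ℝ) / N) - F ((j : ℝ) / N) = 1) :
    cellSum φ F N = deriv φ (F ((j : ℝ) / N)) := by
  rw [cellSum, Finset.sum_eq_single_of_mem j (Finset.mem_range.2 hj)]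
  · rw [show F (((j + 1 : ℕ) : ℝ) / N) = F ((j : ℝ) / N) + 1 by linarith, φ.trapErr_add_one]
  · intro i hi hij
    rw [hF.cell_eq_zero hj h (Finset.mem_range.1 hi) hij, φ.trapErr_self]

/-- If one cell of `F'` carries a full turn, both lifts take values in `F' 0 + ℤ` on the partition.
Then `F` also has exactly one nonzero increment, equal to `1` but possibly in another cell, and both
sums equal `φ'(F' 0)`. -/
theorem cellSum_eq_of_cell_eq_one (φ : SmoothFun) {F F' : ℝ → ℝ} (hF : IsLiftFun F)
    (hF' : IsLiftFun F') (hFF : ∀ x, ∃ n : ℤ, F x = F' x + n) {N j : ℕ} (hj : j < N)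
    (h : F' (((j + 1 : ℕ) : ℝ) / N) - F' ((j : ℝ) / N) = 1) :
    cellSum φ F N = cellSum φ F' N := by
  have hint : ∀ i ≤ N, ∃ n : ℤ, F' ((i : ℝ) / N) = F' 0 + n := by
    intro i
    induction i with
    | zero => exact fun _ => ⟨0, by simp⟩
    | succ i ih =>
      intro hi
      obtain ⟨n, hn⟩ := ih (by omega)
      by_cases hij : i = j
      · subst hij
        exact ⟨n + 1, by push_cast at h ⊢; linarith⟩
      · exact ⟨n, by rw [hF'.cell_eq_zero hj h (by omega) hij, hn]⟩
  have hint' : ∀ i ≤ N, ∃ n : ℤ, F ((i : ℝ) / N) = F' 0 + n := by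
    intro i hi
    obtain ⟨n, hn⟩ := hint i hi
    obtain ⟨m, hm⟩ := hFF ((i : ℝ) / N)
    exact ⟨n + m, by rw [hm, hn]; push_cast; ring⟩
  have hval : ∀ i ≤ N, deriv φ (F ((i : ℝ) / N)) = deriv φ (F' 0) ∧
      deriv φ (F' ((i : ℝ) / N)) = deriv φ (F' 0) := by
    intro i hi
    obtain ⟨n, hn⟩ := hint i hi
    obtain ⟨m, hm⟩ := hint' i hi
    rw [hn, hm]
    exact ⟨φ.der.add_int _ _, φ.der.add_int _ _⟩
  obtain ⟨k, hk, hk'⟩ : ∃ k < N, F (((k + 1 : ℕ) : ℝ) / N) - F ((k : ℝ) / N) ≠ 0 := by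
    by_contra! hcon
    have := hF.sum_cells (Nat.zero_lt_of_lt hj)
    rw [Finset.sum_eq_zero fun i hi => hcon i (Finset.mem_range.1 hi)] at this
    exact zero_ne_one this
  have hk1 : F (((k + 1 : ℕ) : ℝ) / N) - F ((k : ℝ) / N) = 1 := by
    obtain ⟨n, hn⟩ := hint' k hk.le
    obtain ⟨m, hm⟩ := hint' (k + 1) hk
    have h0 := hF.cell_nonneg N k
    have h1 : F (((k + 1 : ℕ) : ℝ) / N) - F ((k : ℝ) / N) ≤ 1 := by
      rw [← hF.sum_cells (Nat.zero_lt_of_lt hj)]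
      exact Finset.single_le_sum
        (f := fun i : ℕ => F (((i + 1 : ℕ) : ℝ) / N) - F ((i : ℝ) / N))
        (fun i _ => hF.cell_nonneg N i) (Finset.mem_range.2 hk)
    have h2 : F (((k + 1 : ℕ) : ℝ) / N) - F ((k : ℝ) / N) = ((m - n : ℤ) : ℝ) := by
      rw [hn, hm]; push_cast; ring
    rw [h2] at h0 h1 hk' ⊢
    have a0 : 0 ≤ m - n := by exact_mod_cast h0
    have a1 : m - n ≤ 1 := by exact_mod_cast h1
    have a2 : m - n ≠ 0 := by exact_mod_cast hk'
    have : m - n = 1 := by omega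
    rw [this]; simp
  rw [cellSum_of_cell_eq_one φ hF hk hk1, cellSum_of_cell_eq_one φ hF' hj h, (hval k hk.le).1,
    (hval j hj.le).2]

/-- Two lifts need not differ by a constant: for a constant circle map the place of the unit jump is
free. Unless a full turn occurs in one cell, all increments lie in `[0, 1)`, which forces the same
integer shift at both ends of each cell. -/
theorem cellSum_eq (φ : SmoothFun) {F F' : ℝ → ℝ} (hF : IsLiftFun F)
    (hF' : IsLiftFun F') (hFF : ∀ x, ∃ n : ℤ, F x = F' x + n) (N : ℕ) :
    cellSum φ F N = cellSum φ F' N := by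
  have hFF' : ∀ x, ∃ n : ℤ, F' x = F x + n := fun x => by
    obtain ⟨n, hn⟩ := hFF x
    exact ⟨-n, by rw [hn]; push_cast; ring⟩
  by_cases h1 : ∃ j < N, F' (((j + 1 : ℕ) : ℝ) / N) - F' ((j : ℝ) / N) = 1
  · obtain ⟨j, hj, h⟩ := h1
    exact cellSum_eq_of_cell_eq_one φ hF hF' hFF hj h
  by_cases h2 : ∃ j < N, F (((j + 1 : ℕ) : ℝ) / N) - F ((j : ℝ) / N) = 1
  · obtain ⟨j, hj, h⟩ := h2
    exact (cellSum_eq_of_cell_eq_one φ hF' hF hFF' hj h).symm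
  push Not at h1 h2
  refine Finset.sum_congr rfl fun i hi => ?_
  have hi' := Finset.mem_range.1 hi
  have hle : ∀ {F : ℝ → ℝ}, IsLiftFun F →
      F (((i + 1 : ℕ) : ℝ) / N) - F ((i : ℝ) / N) ≤ 1 := by
    intro F hF
    rw [← hF.sum_cells (Nat.zero_lt_of_lt hi')]
    exact Finset.single_le_sum
      (f := fun i : ℕ => F (((i + 1 : ℕ) : ℝ) / N) - F ((i : ℝ) / N))
      (fun i _ => hF.cell_nonneg N i) hi
  obtain ⟨n, hn⟩ := hFF ((i : ℝ) / N)
  obtain ⟨m, hm⟩ := hFF (((i + 1 : ℕ) : ℝ) / N)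
  have b1 := lt_of_le_of_ne (hle hF) (h2 i hi')
  have b2 := lt_of_le_of_ne (hle hF') (h1 i hi')
  have c1 := hF.cell_nonneg N i
  have c2 := hF'.cell_nonneg N i
  have hmn : m = n := by
    have d1 : ((m - n : ℤ) : ℝ) < ((1 : ℤ) : ℝ) := by push_cast; linarith
    have d2 : ((-1 : ℤ) : ℝ) < ((m - n : ℤ) : ℝ) := by push_cast; linarith
    have e1 := Int.cast_lt.1 d1
    have e2 := Int.cast_lt.1 d2
    omega
  rw [hn, hm, hmn, φ.trapErr_add_int]

theorem tsum_driftTerm_eq (φ : SmoothFun) {F F' : ℝ → ℝ} {g : G} (hF : IsLift F g)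
    (hF' : IsLift F' g) :
    ∑' a : jumpSet F, driftTerm φ F a = ∑' a : jumpSet F', driftTerm φ F' a := by
  refine tendsto_nhds_unique (tendsto_cellSum φ hF.1) ?_
  rw [funext (cellSum_eq φ hF.1 hF'.1 (lift_eq_add_int hF hF'))]
  exact tendsto_cellSum φ hF'.1

theorem SmoothFun.apply_lift_eq (φ : SmoothFun) {F F' : ℝ → ℝ} {g : G} (hF : IsLift F g)
    (hF' : IsLift F' g) (x : ℝ) : φ (F x) = φ (F' x) := by
  obtain ⟨n, hn⟩ := lift_eq_add_int hF hF' x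
  rw [hn, φ.add_int]

theorem liftDrift_eq (β : ℝ) (φ : SmoothFun) {F F' : ℝ → ℝ} {g : G} (hF : IsLift F g)
    (hF' : IsLift F' g) : liftDrift β φ F = liftDrift β φ F' := by
  rw [liftDrift, liftDrift, tsum_driftTerm_eq φ hF hF']
  simp_rw [← φ.der_apply, φ.der.apply_lift_eq hF hF']

theorem drift_eq (β : ℝ) (φ : SmoothFun) {F : ℝ → ℝ} {g : G} (hF : IsLift F g) :
    drift β φ g = liftDrift β φ F :=
  liftDrift_eq β φ (isLift_lift g) hF

/-! ### Representatives and lengths of segments -/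

/-- The representative in `[0,1)` of a point of the circle. -/
def rep (y : S1) : ℝ := (AddCircle.equivIco (1 : ℝ) 0 y : ℝ)

@[simp] theorem coe_rep (y : S1) : ((rep y : ℝ) : S1) = y := AddCircle.coe_equivIco

theorem measurable_rep : Measurable rep :=
  measurable_subtype_coe.comp (AddCircle.measurableEquivIco 1 0).measurable

theorem measurable_coe : Measurable fun x : ℝ => (x : S1) := AddCircle.measurable_mk'

theorem exists_rep_coe (x : ℝ) : ∃ n : ℤ, rep (x : S1) = x + n :=
  (coe_eq_coe_iff _ _).1 (coe_rep _)

theorem segLen_mem (x y : S1) : segLen x y ∈ Ioc (0 : ℝ) 1 := by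
  have := (AddCircle.equivIoc (1 : ℝ) 0 (y - x)).2
  exact ⟨this.1, this.2.trans_eq (zero_add 1)⟩

theorem coe_segLen (x y : S1) : ((segLen x y : ℝ) : S1) = y - x := AddCircle.coe_equivIoc

theorem measurable_segLen : Measurable fun p : S1 × S1 => segLen p.1 p.2 :=
  (measurable_subtype_coe.comp (AddCircle.measurableEquivIoc 1 0).measurable).comp
    (measurable_snd.sub measurable_fst)

theorem measurable_segLen_apply {ι : Type*} (i j : ι) :
    Measurable fun x : ι → S1 => segLen (x i) (x j) := by
  have h : Measurable fun x : ι → S1 => (x i, x j) := by fun_prop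
  exact measurable_segLen.comp h

theorem segLen_eq {x y : S1} {l : ℝ} (h0 : 0 < l) (h1 : l ≤ 1) (h : ((l : ℝ) : S1) = y - x) :
    segLen x y = l := by
  have h2 := segLen_mem x y
  obtain ⟨n, hn⟩ := (coe_eq_coe_iff _ _).1 ((coe_segLen x y).trans h.symm)
  have h3 : ((-1 : ℤ) : ℝ) < n := by push_cast; linarith [h2.1]
  have h4 : (n : ℝ) < ((1 : ℤ) : ℝ) := by push_cast; linarith [h2.2]
  have h5 := Int.cast_lt.1 h3
  have h6 := Int.cast_lt.1 h4
  have : n = 0 := by omega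
  rw [hn, this]; simp

theorem coe_rep_add_segLen (x y : S1) : ((rep x + segLen x y : ℝ) : S1) = y := by
  rw [AddCircle.coe_add, coe_segLen, coe_rep]; abel

theorem ofNat_add_one {N : ℕ} [NeZero N] (i : Fin N) : Fin.ofNat N (i + 1) = i + 1 := by
  ext; simp [Fin.val_add, Fin.ofNat]

theorem sum_segLen_eq {N : ℕ} [NeZero N] (x : Fin N → S1) (f : S1 → S1 → ℝ) :
    ∑ i, f (x i) (x (i + 1)) =
      ∑ k ∈ Finset.range N, f (x (Fin.ofNat N k)) (x (Fin.ofNat N (k + 1))) := by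
  rw [Finset.sum_range]
  refine Finset.sum_congr rfl fun i _ => ?_
  rw [ofNat_add_one, Fin.ofNat_val_eq_self]

theorem measurableSet_ordered (N : ℕ) [NeZero N] :
    MeasurableSet {x : Fin N → S1 | IsOrderedFamily x} := by
  refine measurableSet_eq_fun (Finset.measurable_sum _ fun i _ => ?_) measurable_const
  exact measurable_segLen_apply i (i + 1)

theorem measurable_dirichletDensity (β : ℝ) {N : ℕ} [NeZero N] (t : Fin N → S1) :
    Measurable (dirichletDensity β t) := by
  classical
  unfold dirichletDensity
  refine Measurable.ite ?_ (measurable_const.mul (Finset.measurable_prod _ fun i _ => ?_))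
    measurable_const
  · exact measurableSet_ordered N
  · exact (measurable_segLen_apply i (i + 1)).pow_const _

/-! ### The action of the flow on the circle -/

namespace SmoothFun

variable (φ : SmoothFun)

/-- The flow on the circle. -/
def circleFlow (t : ℝ) : S1 → S1 := inducedMap (φ.flow t)

theorem circleFlow_coe (t x : ℝ) : φ.circleFlow t (x : S1) = ((φ.flow t x : ℝ) : S1) :=
  inducedMap_coe (φ.isLiftFun_flow t) x

theorem circleFlow_eq (t : ℝ) (y : S1) : φ.circleFlow t y = ((φ.flow t (rep y) : ℝ) : S1) := rfl

theorem measurable_circleFlow (t : ℝ) : Measurable (φ.circleFlow t) :=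
  measurable_coe.comp ((φ.continuous_flow t).measurable.comp measurable_rep)

theorem circleFlow_neg_circleFlow (t : ℝ) (y : S1) :
    φ.circleFlow (-t) (φ.circleFlow t y) = y := by
  rw [circleFlow_eq φ t, circleFlow_coe]
  have := φ.flow_flow_neg (-t) (rep y)
  rw [neg_neg] at this
  rw [this, coe_rep]

theorem segLen_circleFlow_coe (t : ℝ) {a l : ℝ} (h0 : 0 < l) (h1 : l ≤ 1) :
    segLen (φ.circleFlow t (a : S1)) (φ.circleFlow t ((a + l : ℝ) : S1)) =
      φ.flow t (a + l) - φ.flow t a := by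
  refine segLen_eq ?_ ?_ ?_
  · exact sub_pos.2 (φ.flow_strictMono t (by linarith))
  · have := (φ.flow_strictMono t).monotone (show a + l ≤ a + 1 by linarith)
    rw [φ.flow_add_one] at this
    linarith
  · rw [circleFlow_coe, circleFlow_coe, AddCircle.coe_sub]

/-- The logarithm of the distortion of a segment of the circle under the flow. -/
def segDist (t : ℝ) (x y : S1) : ℝ := φ.logDist (rep x) (rep x + segLen x y) t

theorem segLen_circleFlow (t : ℝ) (x y : S1) :
    segLen (φ.circleFlow t x) (φ.circleFlow t y) = segLen x y * Real.exp (φ.segDist t x y) := by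
  have h := segLen_mem x y
  have h1 := φ.segLen_circleFlow_coe t (a := rep x) h.1 h.2
  rw [coe_rep, coe_rep_add_segLen] at h1
  rw [h1, flow_sub_flow, segDist]
  ring_nf

/-- Measurability is read off from the expression as the logarithm of a ratio of segment lengths. -/
theorem measurable_segDist (t : ℝ) : Measurable fun p : S1 × S1 => φ.segDist t p.1 p.2 := by
  have h : (fun p : S1 × S1 => φ.segDist t p.1 p.2) = fun p : S1 × S1 =>
      Real.log (segLen (φ.circleFlow t p.1) (φ.circleFlow t p.2) / segLen p.1 p.2) := by
    funext p
    rw [segLen_circleFlow, mul_div_cancel_left₀ _ (segLen_mem p.1 p.2).1.ne', Real.log_exp]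
  rw [h]
  exact Real.measurable_log.comp ((measurable_segLen.comp
    (((φ.measurable_circleFlow t).comp measurable_fst).prodMk
      ((φ.measurable_circleFlow t).comp measurable_snd))).div measurable_segLen)

/-- An ordered family unrolls to a chain `y 0 < ⋯ < y N = y 0 + 1` on the line. The flow preserves
such chains, and the new lengths telescope to `1`. -/
theorem isOrderedFamily_circleFlow {N : ℕ} [NeZero N] {x : Fin N → S1} (t : ℝ)
    (h : IsOrderedFamily x) : IsOrderedFamily fun i => φ.circleFlow t (x i) := by
  unfold IsOrderedFamily at h ⊢
  rw [sum_segLen_eq x segLen] at h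
  rw [sum_segLen_eq (fun i => φ.circleFlow t (x i)) segLen]
  set X : ℕ → S1 := fun k => x (Fin.ofNat N k) with hX
  set y : ℕ → ℝ := fun k => rep (X 0) + ∑ j ∈ Finset.range k, segLen (X j) (X (j + 1)) with hy
  have hy1 : ∀ k, y (k + 1) = y k + segLen (X k) (X (k + 1)) := fun k => by
    simp only [hy, Finset.sum_range_succ]; ring
  have hyX : ∀ k, ((y k : ℝ) : S1) = X k := by
    intro k
    induction k with
    | zero => simp [hy]
    | succ k ih => rw [hy1, AddCircle.coe_add, ih, coe_segLen]; abel
  have hstep : ∀ k, segLen (φ.circleFlow t (X k)) (φ.circleFlow t (X (k + 1))) =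
      φ.flow t (y (k + 1)) - φ.flow t (y k) := by
    intro k
    have hm := segLen_mem (X k) (X (k + 1))
    have h5 := φ.segLen_circleFlow_coe t (a := y k) hm.1 hm.2
    rwa [← hy1, hyX, hyX] at h5
  rw [Finset.sum_congr rfl fun k _ => hstep k, Finset.sum_range_sub fun k => φ.flow t (y k)]
  have hN : y N = y 0 + 1 := by
    simp only [hy]; rw [h]; simp
  rw [hN, φ.flow_add_one]; ring

theorem isOrderedFamily_circleFlow_iff {N : ℕ} [NeZero N] {x : Fin N → S1} (t : ℝ) :
    IsOrderedFamily (fun i => φ.circleFlow t (x i)) ↔ IsOrderedFamily x := by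
  refine ⟨fun h => ?_, φ.isOrderedFamily_circleFlow t⟩
  have := φ.isOrderedFamily_circleFlow (-t) h
  simpa only [circleFlow_neg_circleFlow] using this

/-- The logarithm of the derivative of the flow, on the circle. -/
def logJac (t : ℝ) (y : S1) : ℝ := φ.logDist (rep y) (rep y) t

theorem measurable_logJac (t : ℝ) : Measurable (φ.logJac t) := by
  have : φ.logJac t = fun y => Real.log (deriv (φ.flow t) (rep y)) := by
    funext y
    rw [deriv_flow, Real.log_exp, logJac]
  rw [this]
  exact Real.measurable_log.comp ((measurable_deriv _).comp measurable_rep)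

theorem logJac_coe (t x : ℝ) : φ.logJac t (x : S1) = φ.logDist x x t := by
  obtain ⟨n, hn⟩ := exists_rep_coe x
  rw [logJac, hn, logDist_add_int]

theorem image_flow_Ioc (t a b : ℝ) : φ.flow t '' Ioc a b = Ioc (φ.flow t a) (φ.flow t b) :=
  (StrictMono.orderIsoOfSurjective (φ.flow t) (φ.flow_strictMono t)
    fun x => ⟨φ.flow (-t) x, φ.flow_flow_neg t x⟩).image_Ioc a b

/-- Change of variables on the line: the flow maps the period `(0, 1]` onto the period that starts
at `φ.flow t 0`. -/
theorem lintegral_circleFlow (t : ℝ) (f : S1 → ENNReal) :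
    ∫⁻ y, ENNReal.ofReal (Real.exp (φ.logJac t y)) * f (φ.circleFlow t y) = ∫⁻ y, f y := by
  rw [← UnitAddCircle.lintegral_preimage 0, ← UnitAddCircle.lintegral_preimage (φ.flow t 0),
    ← φ.flow_add_one, ← image_flow_Ioc,
    lintegral_image_eq_lintegral_abs_deriv_mul measurableSet_Ioc
      (fun x _ => (φ.hasDerivAt_flow_space t x).hasDerivWithinAt)
      (φ.flow_strictMono t).injective.injOn]
  refine lintegral_congr fun x => ?_
  rw [abs_of_pos (Real.exp_pos _)]
  congr 2
  · rw [← logJac_coe]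
  · exact φ.circleFlow_coe t x

theorem map_circleFlow_withDensity (t : ℝ) :
    ((volume : Measure S1).withDensity fun y => ENNReal.ofReal (Real.exp (φ.logJac t y))).map
      (φ.circleFlow t) = volume := by
  have hm : Measurable fun y => ENNReal.ofReal (Real.exp (φ.logJac t y)) :=
    (Real.measurable_exp.comp (φ.measurable_logJac t)).ennreal_ofReal
  refine Measure.ext_of_lintegral _ fun f hf => ?_
  rw [lintegral_map hf (φ.measurable_circleFlow t), lintegral_withDensity_eq_lintegral_mul _ hm
    (g := fun y => f (φ.circleFlow t y)) (hf.comp (φ.measurable_circleFlow t)), ← φ.lintegral_circleFlow t f]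
  rfl

theorem abs_logJac_le {K : ℝ} (hK : ∀ x, |deriv φ x| ≤ K) (t : ℝ) (y : S1) :
    |φ.logJac t y| ≤ K * |t| := φ.abs_logDist_le hK _ _ _

end SmoothFun

/-- Checked on rectangles by Fubini; this transfers the one-dimensional Jacobian to powers of the
circle. -/
theorem pi_withDensity_exp {ι X : Type*} [Fintype ι] [MeasurableSpace X] (μ : Measure X)
    [IsFiniteMeasure μ] {f : X → ℝ} (hf : Measurable f) {C : ℝ} (hC : ∀ x, |f x| ≤ C) :
    (Measure.pi fun _ : ι => μ).withDensity (fun x => ENNReal.ofReal (Real.exp (∑ i, f (x i)))) =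
      Measure.pi fun _ : ι => μ.withDensity fun x => ENNReal.ofReal (Real.exp (f x)) := by
  have hfe : Measurable fun x => Real.exp (f x) := Real.measurable_exp.comp hf
  have hint : ∀ ν : Measure X, IsFiniteMeasure ν → Integrable (fun x => Real.exp (f x)) ν := by
    intro ν _
    refine Integrable.of_bound hfe.aestronglyMeasurable (Real.exp C) (ae_of_all _ fun x => ?_)
    rw [Real.norm_eq_abs, Real.abs_exp]
    exact Real.exp_le_exp.2 (abs_le.1 (hC x)).2
  have hfin : IsFiniteMeasure (μ.withDensity fun x => ENNReal.ofReal (Real.exp (f x))) :=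
    isFiniteMeasure_withDensity_ofReal (hint μ inferInstance).2
  refine (Measure.pi_eq fun s hs => ?_).symm
  rw [withDensity_apply _ (MeasurableSet.univ_pi hs), Measure.restrict_pi_pi,
    ← ofReal_integral_eq_lintegral_ofReal]
  · simp_rw [Real.exp_sum]
    rw [integral_fintype_prod_eq_prod (fun _ x => Real.exp (f x)),
      ENNReal.ofReal_prod_of_nonneg fun i _ => integral_nonneg fun x => (Real.exp_pos _).le]
    refine Finset.prod_congr rfl fun i _ => ?_
    rw [withDensity_apply _ (hs i), ofReal_integral_eq_lintegral_ofReal (hint _ inferInstance)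
      (ae_of_all _ fun x => (Real.exp_pos _).le)]
  · simp_rw [Real.exp_sum]
    exact Integrable.fintype_prod fun i => hint _ inferInstance
  · exact ae_of_all _ fun x => (Real.exp_pos _).le

section

namespace SmoothFun

variable (φ : SmoothFun)

/-! ### Quasi-invariance of the finite dimensional distributions -/

/-- The flow acting diagonally on a power of the circle. -/
def torusFlow {ι : Type*} (t : ℝ) (x : ι → S1) : ι → S1 := fun i => φ.circleFlow t (x i)

theorem measurable_torusFlow {ι : Type*} (t : ℝ) :
    Measurable (φ.torusFlow t : (ι → S1) → ι → S1) :=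
  measurable_pi_lambda _ fun i => (φ.measurable_circleFlow t).comp (measurable_pi_apply i)

/-- The logarithm of the density of the image of a finite dimensional distribution; `α` is the
family of the exponents. -/
def logDens {N : ℕ} [NeZero N] (α : Fin N → ℝ) (t : ℝ) (x : Fin N → S1) : ℝ :=
  ∑ i, φ.logJac t (x i) + ∑ i, α i * φ.segDist t (x i) (x (i + 1))

/-- The time derivative of `logDens`. -/
def logDens' {N : ℕ} [NeZero N] (α : Fin N → ℝ) (t : ℝ) (x : Fin N → S1) : ℝ :=
  ∑ i, deriv φ (φ.flow t (rep (x i))) +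
    ∑ i, α i * φ.avgSlope (φ.flow t (rep (x i)))
      (φ.flow t (rep (x i) + segLen (x i) (x (i + 1))))

variable {N : ℕ} [NeZero N]

theorem measurable_segDist_apply {ι : Type*} (t : ℝ) (i j : ι) :
    Measurable fun x : ι → S1 => φ.segDist t (x i) (x j) := by
  have h : Measurable fun x : ι → S1 => (x i, x j) := by fun_prop
  have h2 := (φ.measurable_segDist t).comp h
  rw [Function.comp_def] at h2
  exact h2

theorem measurable_logDens (α : Fin N → ℝ) (t : ℝ) : Measurable (φ.logDens α t) :=
  (Finset.measurable_sum _ fun i _ => (φ.measurable_logJac t).comp (measurable_pi_apply i)).add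
    (Finset.measurable_sum _ fun i _ => (φ.measurable_segDist_apply t i (i + 1)).const_mul _)

theorem measurable_logDens' (α : Fin N → ℝ) (t : ℝ) : Measurable (φ.logDens' α t) := by
  have hr : ∀ i : Fin N, Measurable fun x : Fin N → S1 => rep (x i) := fun i =>
    measurable_rep.comp (measurable_pi_apply i)
  refine (Finset.measurable_sum _ fun i _ => ?_).add (Finset.measurable_sum _ fun i _ => ?_)
  · exact φ.continuous_deriv.measurable.comp ((φ.continuous_flow t).measurable.comp (hr i))
  · refine Measurable.const_mul ?_ _
    exact φ.continuous_avgSlope.measurable.comp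
      (((φ.continuous_flow t).measurable.comp (hr i)).prodMk
        ((φ.continuous_flow t).measurable.comp ((hr i).add (measurable_segLen_apply i (i + 1)))))

@[simp] theorem logDens_zero (α : Fin N → ℝ) (x : Fin N → S1) : φ.logDens α 0 x = 0 := by
  simp [logDens, logJac, segDist]

theorem hasDerivAt_logDens (α : Fin N → ℝ) (x : Fin N → S1) (t : ℝ) :
    HasDerivAt (fun t => φ.logDens α t x) (φ.logDens' α t x) t := by
  refine (HasDerivAt.fun_sum fun i _ => ?_).add (HasDerivAt.fun_sum fun i _ => ?_)
  · exact (φ.hasDerivAt_logDist _ _ t).congr_deriv (φ.avgSlope_self _)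
  · exact (φ.hasDerivAt_logDist _ _ t).const_mul _

theorem exists_logDens_bound (α : Fin N → ℝ) : ∃ A : ℝ, 0 ≤ A ∧
    ∀ x t, |φ.logDens α t x| ≤ A * |t| ∧ |φ.logDens' α t x| ≤ A := by
  obtain ⟨K, hK0, hK⟩ := φ.der.exists_abs_le
  refine ⟨∑ _i : Fin N, K + ∑ i, |α i| * K, by positivity, fun x t => ⟨?_, ?_⟩⟩
  · rw [add_mul, Finset.sum_mul, Finset.sum_mul]
    refine (abs_add_le _ _).trans (add_le_add ?_ ?_)
    · exact (Finset.abs_sum_le_sum_abs _ _).trans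
        (Finset.sum_le_sum fun i _ => φ.abs_logJac_le hK _ _)
    · refine (Finset.abs_sum_le_sum_abs _ _).trans (Finset.sum_le_sum fun i _ => ?_)
      rw [abs_mul, mul_assoc]
      exact mul_le_mul_of_nonneg_left (φ.abs_logDist_le hK _ _ _) (abs_nonneg _)
  · refine (abs_add_le _ _).trans (add_le_add ?_ ?_)
    · exact (Finset.abs_sum_le_sum_abs _ _).trans (Finset.sum_le_sum fun i _ => hK _)
    · refine (Finset.abs_sum_le_sum_abs _ _).trans (Finset.sum_le_sum fun i _ => ?_)
      rw [abs_mul]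
      exact mul_le_mul_of_nonneg_left (φ.abs_avgSlope_le hK _ _) (abs_nonneg _)

theorem map_torusFlow_pi {ι : Type*} [Fintype ι] (t : ℝ) :
    ((Measure.pi fun _ : ι => (volume : Measure S1)).withDensity
      fun x => ENNReal.ofReal (Real.exp (∑ i, φ.logJac t (x i)))).map (φ.torusFlow t) =
        Measure.pi fun _ => volume := by
  obtain ⟨K, hK0, hK⟩ := φ.der.exists_abs_le
  rw [pi_withDensity_exp _ (φ.measurable_logJac t) (φ.abs_logJac_le hK t)]
  have hs : ∀ _ : ι, SigmaFinite (((volume : Measure S1).withDensity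
      fun y => ENNReal.ofReal (Real.exp (φ.logJac t y))).map (φ.circleFlow t)) := fun _ => by
    rw [map_circleFlow_withDensity]; infer_instance
  have := Measure.pi_map_pi (μ := fun _ : ι => (volume : Measure S1).withDensity
    fun y => ENNReal.ofReal (Real.exp (φ.logJac t y))) (f := fun _ => φ.circleFlow t) (hμ := hs)
    fun _ => (φ.measurable_circleFlow t).aemeasurable
  rw [map_circleFlow_withDensity] at this
  exact this

/-- The flow preserves orderedness and multiplies each segment length by `exp (segDist)`, which
enters raised to the Dirichlet exponent; the Gamma factors do not change. -/
theorem dirichletDensity_torusFlow (β : ℝ) (s x : Fin N → S1) (t : ℝ) :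
    Real.exp (∑ i, φ.logJac t (x i)) * dirichletDensity β s (φ.torusFlow t x) =
      dirichletDensity β s x *
        Real.exp (φ.logDens (fun i => β * segLen (s i) (s (i + 1)) - 1) t x) := by
  have hiff := φ.isOrderedFamily_circleFlow_iff (x := x) t
  by_cases h : IsOrderedFamily x
  · rw [dirichletDensity, dirichletDensity, if_pos h]
    unfold torusFlow
    rw [if_pos (hiff.2 h)]
    simp only [segLen_circleFlow]
    rw [Finset.prod_congr rfl fun i _ => Real.mul_rpow (segLen_mem (x i) (x (i + 1))).1.le
      (Real.exp_pos _).le, Finset.prod_mul_distrib, logDens, Real.exp_add,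
      Real.exp_sum Finset.univ fun i =>
        (β * segLen (s i) (s (i + 1)) - 1) * φ.segDist t (x i) (x (i + 1))]
    simp only [← Real.exp_mul, mul_comm (φ.segDist t _ _)]
    ring
  · rw [dirichletDensity, dirichletDensity, if_neg h]
    unfold torusFlow
    rw [if_neg (fun h' => h (hiff.1 h'))]
    simp

/-- The finite dimensional distribution of the Dirichlet process. -/
def _root_.CircleMap.dirichletLaw (β : ℝ) (s : Fin N → S1) : Measure (Fin N → S1) :=
  (Measure.pi fun _ : Fin N => (volume : Measure S1)).withDensity
    fun x => ENNReal.ofReal (dirichletDensity β s x)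

theorem lintegral_torusFlow (β : ℝ) (s : Fin N → S1) (t : ℝ) {f : (Fin N → S1) → ENNReal}
    (hf : Measurable f) :
    ∫⁻ x, f (φ.torusFlow t x) * ENNReal.ofReal
      (Real.exp (φ.logDens (fun i => β * segLen (s i) (s (i + 1)) - 1) t x)) ∂dirichletLaw β s =
        ∫⁻ x, f x ∂dirichletLaw β s := by
  have hρ : Measurable fun x => ENNReal.ofReal (dirichletDensity β s x) :=
    (measurable_dirichletDensity β s).ennreal_ofReal
  have hT : Measurable (φ.torusFlow t : (Fin N → S1) → Fin N → S1) := φ.measurable_torusFlow t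
  have hJ : Measurable fun x : Fin N → S1 =>
      ENNReal.ofReal (Real.exp (∑ i, φ.logJac t (x i))) :=
    (Real.measurable_exp.comp (Finset.measurable_sum _ fun i _ =>
      (φ.measurable_logJac t).comp (measurable_pi_apply i))).ennreal_ofReal
  have hY : Measurable fun x => ENNReal.ofReal
      (Real.exp (φ.logDens (fun i => β * segLen (s i) (s (i + 1)) - 1) t x)) :=
    (Real.measurable_exp.comp (φ.measurable_logDens
    (fun i => β * segLen (s i) (s (i + 1)) - 1) t)).ennreal_ofReal
  rw [dirichletLaw, lintegral_withDensity_eq_lintegral_mul _ hρ hf,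
    lintegral_withDensity_eq_lintegral_mul _ hρ (g := fun x => f (φ.torusFlow t x) *
      ENNReal.ofReal (Real.exp (φ.logDens (fun i => β * segLen (s i) (s (i + 1)) - 1) t x)))
      ((hf.comp hT).mul hY)]
  conv_rhs => rw [← φ.map_torusFlow_pi t]
  rw [lintegral_map (hρ.mul hf) hT]
  simp only [Pi.mul_apply]
  rw [lintegral_withDensity_eq_lintegral_mul _ hJ
    (g := fun x => ENNReal.ofReal (dirichletDensity β s (φ.torusFlow t x)) *
      f (φ.torusFlow t x)) ((hρ.mul hf).comp hT)]
  refine lintegral_congr fun x => ?_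
  simp only [Pi.mul_apply]
  rw [← mul_assoc (ENNReal.ofReal (Real.exp (∑ i, φ.logJac t (x i)))),
    ← ENNReal.ofReal_mul (Real.exp_pos _).le, dirichletDensity_torusFlow,
    ENNReal.ofReal_mul' (Real.exp_pos _).le]
  ring

theorem integral_torusFlow (β : ℝ) (s : Fin N → S1) (t : ℝ) {f : (Fin N → S1) → ℝ}
    (hf : Measurable f) :
    ∫ x, f (φ.torusFlow t x) *
      Real.exp (φ.logDens (fun i => β * segLen (s i) (s (i + 1)) - 1) t x) ∂dirichletLaw β s =
        ∫ x, f x ∂dirichletLaw β s := by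
  have hT : Measurable (φ.torusFlow t : (Fin N → S1) → Fin N → S1) := φ.measurable_torusFlow t
  have hY : Measurable fun x => ENNReal.ofReal
      (Real.exp (φ.logDens (fun i => β * segLen (s i) (s (i + 1)) - 1) t x)) :=
    (Real.measurable_exp.comp (φ.measurable_logDens
    (fun i => β * segLen (s i) (s (i + 1)) - 1) t)).ennreal_ofReal
  have hmap : ((dirichletLaw β s).withDensity fun x => ENNReal.ofReal
      (Real.exp (φ.logDens (fun i => β * segLen (s i) (s (i + 1)) - 1) t x))).map
        (φ.torusFlow t) = dirichletLaw β s := by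
    refine Measure.ext_of_lintegral _ fun g hg => ?_
    rw [lintegral_map hg hT, lintegral_withDensity_eq_lintegral_mul _ hY
      (g := fun x => g (φ.torusFlow t x)) (hg.comp hT), ← φ.lintegral_torusFlow β s t hg]
    exact lintegral_congr fun x => mul_comm _ _
  conv_rhs => rw [← hmap]
  rw [integral_map hT.aemeasurable hf.aestronglyMeasurable,
    integral_withDensity_eq_integral_toReal_smul hY (ae_of_all _ fun x => ENNReal.ofReal_lt_top)]
  refine integral_congr_ae (ae_of_all _ fun x => ?_)
  simp only [ENNReal.toReal_ofReal (Real.exp_pos _).le, smul_eq_mul]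
  ring

/-- Integration by parts for the finite dimensional distributions. -/
theorem integral_deriv_add_eq_zero (β : ℝ) (s : Fin N → S1)
    (hfin : IsFiniteMeasure (dirichletLaw β s)) {f : (Fin N → S1) → ℝ}
    {f' : ℝ → (Fin N → S1) → ℝ} (hf : Measurable f) (hf' : Measurable (f' 0)) {C B : ℝ}
    (hC : ∀ x, |f x| ≤ C) (hB : ∀ t x, |f' t x| ≤ B)
    (hd : ∀ x t, HasDerivAt (fun t => f (φ.torusFlow t x)) (f' t x) t) :
    ∫ x, (f' 0 x + f x * φ.logDens' (fun i => β * segLen (s i) (s (i + 1)) - 1) 0 x)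
      ∂dirichletLaw β s = 0 := by
  set α : Fin N → ℝ := fun i => β * segLen (s i) (s (i + 1)) - 1 with hα
  obtain ⟨A, hA0, hA⟩ := φ.exists_logDens_bound α
  have hC0 : 0 ≤ C := (abs_nonneg _).trans (hC fun _ => 0)
  have hB0 : 0 ≤ B := (abs_nonneg _).trans (hB 0 fun _ => 0)
  have hflow0 : ∀ x : Fin N → S1, φ.torusFlow 0 x = x := fun x => by
    funext i
    rw [torusFlow, circleFlow_eq, flow_zero, coe_rep]
  have hmeas : ∀ t, Measurable fun x => f (φ.torusFlow t x) * Real.exp (φ.logDens α t x) :=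
    fun t => (hf.comp (φ.measurable_torusFlow t)).mul
      (Real.measurable_exp.comp (φ.measurable_logDens α t))
  have key := (hasDerivAt_integral_of_dominated_loc_of_deriv_le
    (μ := dirichletLaw β s) (x₀ := (0 : ℝ)) (s := Metric.ball 0 1)
    (F := fun t x => f (φ.torusFlow t x) * Real.exp (φ.logDens α t x))
    (F' := fun t x => f' t x * Real.exp (φ.logDens α t x) +
      f (φ.torusFlow t x) * (Real.exp (φ.logDens α t x) * φ.logDens' α t x))
    (bound := fun _ => B * Real.exp A + C * (Real.exp A * A))
    (Metric.ball_mem_nhds 0 one_pos)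
    (Eventually.of_forall fun t => (hmeas t).aestronglyMeasurable)
    (Integrable.of_bound (hmeas 0).aestronglyMeasurable C (ae_of_all _ fun x => by
      simpa [hflow0] using hC x))
    ((hf'.mul (Real.measurable_exp.comp (φ.measurable_logDens α 0))).add
      ((hf.comp (φ.measurable_torusFlow 0)).mul ((Real.measurable_exp.comp
        (φ.measurable_logDens α 0)).mul (φ.measurable_logDens' α 0)))).aestronglyMeasurable
    (ae_of_all _ fun x t ht => by
      rw [mem_ball_zero_iff, Real.norm_eq_abs] at ht
      have h1 : Real.exp (φ.logDens α t x) ≤ Real.exp A :=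
        Real.exp_le_exp.2 ((le_abs_self _).trans ((hA x t).1.trans
          (mul_le_of_le_one_right hA0 ht.le)))
      refine (norm_add_le _ _).trans (add_le_add ?_ ?_)
      · rw [Real.norm_eq_abs, abs_mul, Real.abs_exp]
        exact mul_le_mul (hB t x) h1 (Real.exp_pos _).le hB0
      · rw [Real.norm_eq_abs, abs_mul, abs_mul, Real.abs_exp]
        exact mul_le_mul (hC _) (mul_le_mul h1 (hA x t).2 (abs_nonneg _) (Real.exp_pos _).le)
          (mul_nonneg (Real.exp_pos _).le (abs_nonneg _)) hC0)
    (integrable_const _)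
    (ae_of_all _ fun x t _ => (hd x t).mul (φ.hasDerivAt_logDens α x t).exp)).2
  -- Quasi-invariance makes the integral independent of time, so the derivative computed under the
  -- integral sign is zero.
  have hconst : (fun t => ∫ x, f (φ.torusFlow t x) * Real.exp (φ.logDens α t x)
      ∂dirichletLaw β s) = fun _ => ∫ x, f x ∂dirichletLaw β s :=
    funext fun t => φ.integral_torusFlow β s t hf
  rw [hconst] at key
  have := key.unique (hasDerivAt_const _ _)
  simpa [hflow0] using this

end SmoothFun

/-! ### The regular partition of the circle -/

/-- The regular partition. -/
def regularPartition (N : ℕ) (i : Fin N) : S1 := ((((i : ℕ) : ℝ) / N : ℝ) : S1)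

variable {N : ℕ} [NeZero N]

theorem regularPartition_add_one (i : Fin N) :
    regularPartition N (i + 1) = (((((i : ℕ) + 1 : ℕ) : ℝ) / N : ℝ) : S1) := by
  have hN : (N : ℝ) ≠ 0 := by exact_mod_cast NeZero.ne N
  by_cases h : (i : ℕ) + 1 = N
  · have h1 : i + 1 = 0 := by
      rw [← ofNat_add_one, h, Fin.ofNat_self]
    rw [h1, h, div_self hN, regularPartition, coe_eq_coe_iff]
    exact ⟨-1, by simp⟩
  · have h1 : ((i + 1 : Fin N) : ℕ) = i + 1 := by
      rw [← ofNat_add_one]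
      exact Nat.mod_eq_of_lt (by omega)
    rw [regularPartition, h1]

theorem segLen_regularPartition (i : Fin N) :
    segLen (regularPartition N i) (regularPartition N (i + 1)) = 1 / N := by
  have hN : (0 : ℝ) < N := by exact_mod_cast NeZero.pos N
  refine segLen_eq (by positivity) ?_ ?_
  · rw [div_le_one hN]; exact_mod_cast NeZero.pos N
  · rw [regularPartition_add_one, regularPartition, ← AddCircle.coe_sub]
    congr 1
    push_cast; ring

theorem isOrderedFamily_regularPartition : IsOrderedFamily (regularPartition N) := by
  have hN : (N : ℝ) ≠ 0 := by exact_mod_cast NeZero.ne N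
  unfold IsOrderedFamily
  simp [segLen_regularPartition, hN]

theorem apply_coe_of_isLift {F : ℝ → ℝ} {g : G} (hF : IsLift F g) (x : ℝ) :
    (g : S1 → S1) (x : S1) = ((F x : ℝ) : S1) := by
  rw [← hF.2, inducedMap_coe hF.1]

/-- If the values on the regular partition form an ordered family, then the lengths of the
segments between them are the increments of any lift. -/
theorem segLen_eq_cell {F : ℝ → ℝ} {g : G} (hF : IsLift F g)
    (h : IsOrderedFamily fun i => (g : S1 → S1) (regularPartition N i)) (i : Fin N) :
    segLen ((g : S1 → S1) (regularPartition N i)) ((g : S1 → S1) (regularPartition N (i + 1))) =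
      F ((((i : ℕ) + 1 : ℕ) : ℝ) / N) - F (((i : ℕ) : ℝ) / N) := by
  have hle1 : ∀ i : Fin N, F ((((i : ℕ) + 1 : ℕ) : ℝ) / N) - F (((i : ℕ) : ℝ) / N) ≤ 1 := by
    intro i
    rw [← hF.1.sum_cells (NeZero.pos N)]
    exact Finset.single_le_sum
      (f := fun i : ℕ => F (((i + 1 : ℕ) : ℝ) / N) - F ((i : ℝ) / N))
      (fun i _ => hF.1.cell_nonneg N i) (Finset.mem_range.2 i.2)
  have hcoe : ∀ i : Fin N, ((F ((((i : ℕ) + 1 : ℕ) : ℝ) / N) - F (((i : ℕ) : ℝ) / N) : ℝ) : S1) =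
      (g : S1 → S1) (regularPartition N (i + 1)) - (g : S1 → S1) (regularPartition N i) := by
    intro i
    rw [regularPartition_add_one, regularPartition, apply_coe_of_isLift hF,
      apply_coe_of_isLift hF, AddCircle.coe_sub]
  -- The inequality is strict only for a zero increment, where `segLen` is `1`. Both sides sum to
  -- `1`, hence agree termwise.
  have hle : ∀ i : Fin N, F ((((i : ℕ) + 1 : ℕ) : ℝ) / N) - F (((i : ℕ) : ℝ) / N) ≤
      segLen ((g : S1 → S1) (regularPartition N i))
        ((g : S1 → S1) (regularPartition N (i + 1))) := by
    intro i
    rcases (hF.1.cell_nonneg N i).eq_or_lt with h0 | h0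
    · rw [← h0]; exact (segLen_mem _ _).1.le
    · exact (segLen_eq h0 (hle1 i) (hcoe i)).ge
  have hsum := hF.1.sum_cells (NeZero.pos N)
  rw [Finset.sum_range] at hsum
  exact ((Finset.sum_eq_sum_iff_of_le fun i _ => hle i).1 (hsum.trans h.symm) i
    (Finset.mem_univ i)).symm

/-- The exponents are `β / N - 1`. The part `β / N` gives `β * cellMean`. The part `-1` joins the
divergence `∑ φ'`, which by periodicity may be averaged over left and right end points, to give the
trapezoid errors. -/
theorem logDens'_eq (φ : SmoothFun) (β : ℝ) {F : ℝ → ℝ} {g : G} (hF : IsLift F g)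
    (h : IsOrderedFamily fun i => (g : S1 → S1) (regularPartition N i)) :
    φ.logDens' (fun i => β * segLen (regularPartition N i) (regularPartition N (i + 1)) - 1) 0
      (fun i => (g : S1 → S1) (regularPartition N i)) =
        cellSum φ F N + β * cellMean φ F N := by
  have hrep : ∀ i : Fin N, ∃ n : ℤ, rep ((g : S1 → S1) (regularPartition N i)) =
      F (((i : ℕ) : ℝ) / N) + n := fun i => by
    rw [regularPartition, apply_coe_of_isLift hF]
    exact exists_rep_coe _
  have h1 : ∀ i : Fin N, deriv φ (rep ((g : S1 → S1) (regularPartition N i))) =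
      deriv φ (F (((i : ℕ) : ℝ) / N)) := fun i => by
    obtain ⟨n, hn⟩ := hrep i
    rw [hn]; exact φ.der.add_int _ _
  have h2 : ∀ i : Fin N, φ.avgSlope (rep ((g : S1 → S1) (regularPartition N i)))
      (rep ((g : S1 → S1) (regularPartition N i)) +
        segLen ((g : S1 → S1) (regularPartition N i))
          ((g : S1 → S1) (regularPartition N (i + 1)))) =
      φ.avgSlope (F (((i : ℕ) : ℝ) / N)) (F ((((i : ℕ) + 1 : ℕ) : ℝ) / N)) := fun i => by
    obtain ⟨n, hn⟩ := hrep i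
    rw [segLen_eq_cell hF h, hn, ← φ.avgSlope_add_int (F (((i : ℕ) : ℝ) / N))
      (F ((((i : ℕ) + 1 : ℕ) : ℝ) / N)) n]
    congr 1; ring
  have h3 : ∑ i ∈ Finset.range N, deriv φ (F (((i + 1 : ℕ) : ℝ) / N)) =
      ∑ i ∈ Finset.range N, deriv φ (F ((i : ℝ) / N)) := by
    rw [← sub_eq_zero, ← Finset.sum_sub_distrib,
      Finset.sum_range_sub fun i : ℕ => deriv φ (F ((i : ℝ) / N))]
    have hN : (N : ℝ) ≠ 0 := by exact_mod_cast NeZero.ne N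
    have h4 := hF.1.add_one 0
    have h5 := φ.der.periodic (F 0)
    simp only [SmoothFun.der_apply, zero_add] at h4 h5
    simp [hN, h4, h5]
  rw [SmoothFun.logDens']
  simp only [SmoothFun.flow_zero, h1, h2, segLen_regularPartition]
  rw [← Finset.sum_range fun i : ℕ => deriv φ (F ((i : ℝ) / N)),
    ← Finset.sum_range fun i : ℕ => (β * (1 / (N : ℝ)) - 1) *
      φ.avgSlope (F ((i : ℝ) / N)) (F (((i + 1 : ℕ) : ℝ) / N)), cellSum, cellMean]
  simp only [SmoothFun.trapErr, sub_mul, one_mul, Finset.sum_sub_distrib, add_div,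
    Finset.sum_add_distrib, ← Finset.sum_div, h3, Finset.mul_sum, mul_assoc]
  ring

theorem measurable_eval (x : S1) : Measurable fun g : G => (g : S1 → S1) x :=
  (measurable_pi_apply x).comp measurable_subtype_coe

/-- Integration by parts for functions of the values on the regular partition. -/
theorem integral_regularPartition (φ : SmoothFun) {β : ℝ} {Q : Measure G}
    (hQ : IsDirichletProcess β Q) {f : (Fin N → S1) → ℝ}
    {f' : ℝ → (Fin N → S1) → ℝ} (hf : Measurable f) (hf' : Measurable (f' 0)) {C B : ℝ}
    (hC : ∀ x, |f x| ≤ C) (hB : ∀ t x, |f' t x| ≤ B)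
    (hd : ∀ x t, HasDerivAt (fun t => f (φ.torusFlow t x)) (f' t x) t) :
    (∀ᵐ g : G ∂Q, φ.logDens'
      (fun i => β * segLen (regularPartition N i) (regularPartition N (i + 1)) - 1) 0
        (fun i => (g : S1 → S1) (regularPartition N i)) =
          cellSum φ (lift g) N + β * cellMean φ (lift g) N) ∧
    ∫ g : G, (f' 0 (fun i => (g : S1 → S1) (regularPartition N i)) +
      f (fun i => (g : S1 → S1) (regularPartition N i)) *
        (cellSum φ (lift g) N + β * cellMean φ (lift g) N)) ∂Q = 0 := by
  have hQp := hQ.isProb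
  have hev : Measurable fun (g : G) (i : Fin N) => (g : S1 → S1) (regularPartition N i) :=
    measurable_pi_lambda _ fun i => measurable_eval _
  have hlaw : Q.map (fun (g : G) (i : Fin N) => (g : S1 → S1) (regularPartition N i)) =
      dirichletLaw β (regularPartition N) :=
    hQ.fidi N (regularPartition N) isOrderedFamily_regularPartition
  have hfin : IsFiniteMeasure (dirichletLaw β (regularPartition N)) := by
    rw [← hlaw]; infer_instance
  have hord : ∀ᵐ x ∂dirichletLaw β (regularPartition N), IsOrderedFamily x := by
    rw [dirichletLaw, ae_withDensity_iff
      (measurable_dirichletDensity β (regularPartition N)).ennreal_ofReal]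
    refine ae_of_all _ fun x hx => ?_
    by_contra hcon
    rw [dirichletDensity, if_neg hcon] at hx
    simp at hx
  rw [← hlaw] at hord
  have hord' := ae_of_ae_map hev.aemeasurable hord
  -- Also part of the conclusion: `lift` is chosen arbitrarily, and this identity with a measurable
  -- function of the values of `g` later makes the drift measurable.
  have hae : ∀ᵐ g : G ∂Q, φ.logDens'
      (fun i => β * segLen (regularPartition N i) (regularPartition N (i + 1)) - 1) 0
        (fun i => (g : S1 → S1) (regularPartition N i)) =
          cellSum φ (lift g) N + β * cellMean φ (lift g) N := by
    filter_upwards [hord'] with g hg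
    exact logDens'_eq φ β (isLift_lift g) hg
  refine ⟨hae, ?_⟩
  have h := φ.integral_deriv_add_eq_zero β (regularPartition N) hfin hf hf' hC hB hd
  rw [← hlaw, integral_map hev.aemeasurable
    (f := fun x => f' 0 x + f x * φ.logDens' _ 0 x)
    (hf'.add (hf.mul (φ.measurable_logDens' _ _))).aestronglyMeasurable] at h
  refine Eq.trans (integral_congr_ae ?_) h
  filter_upwards [hae] with g hg
  rw [hg]

end

/-! ### Functions on powers of the circle -/

theorem exists_rep_coe_pi {ι : Type*} (y : ι → ℝ) :
    ∃ n : ι → ℤ, (fun i => rep (y i : S1)) = y + fun i => (n i : ℝ) := by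
  choose n hn using fun i => exists_rep_coe (y i)
  exact ⟨n, funext fun i => hn i⟩

theorem exists_bound_rep {ι : Type*} [Fintype ι] {f : (ι → ℝ) → ℝ} (hf : Continuous f) :
    ∃ C : ℝ, ∀ z : ι → S1, |f fun i => rep (z i)| ≤ C := by
  obtain ⟨C, hC⟩ := (isCompact_Icc (a := (0 : ι → ℝ)) (b := 1)).exists_bound_of_continuousOn
    hf.continuousOn
  refine ⟨C, fun z => hC _ ⟨fun i => ?_, fun i => ?_⟩⟩
  · exact (AddCircle.equivIco (1 : ℝ) 0 (z i)).2.1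
  · have := (AddCircle.equivIco (1 : ℝ) 0 (z i)).2.2
    exact (this.trans_eq (zero_add 1)).le

theorem measurable_comp_rep {ι : Type*} [Fintype ι] {f : (ι → ℝ) → ℝ} (hf : Continuous f) :
    Measurable fun z : ι → S1 => f fun i => rep (z i) :=
  hf.measurable.comp (measurable_pi_lambda _ fun i => measurable_rep.comp (measurable_pi_apply i))

namespace SmoothFun

variable (φ : SmoothFun) {ι : Type*} [Fintype ι]

/-- The derivative of a function of several variables along the vector field `(φ,…,φ)`. -/
def fieldDeriv (U : (ι → ℝ) → ℝ) (y : ι → ℝ) : ℝ := fderiv ℝ U y fun i => φ (y i)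

theorem continuous_fieldDeriv {U : (ι → ℝ) → ℝ} (hU : ContDiff ℝ 1 U) :
    Continuous (φ.fieldDeriv U) := by
  have h1 := hU.continuous_fderiv one_ne_zero
  have h2 := φ.continuous
  exact h1.clm_apply (by fun_prop)

theorem fieldDeriv_add_int {U : (ι → ℝ) → ℝ}
    (hU : ∀ (y : ι → ℝ) (n : ι → ℤ), U (y + fun i => (n i : ℝ)) = U y) (y : ι → ℝ) (n : ι → ℤ) :
    φ.fieldDeriv U (y + fun i => (n i : ℝ)) = φ.fieldDeriv U y := by
  unfold fieldDeriv
  rw [← fderiv_comp_add_right]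
  simp only [hU, Pi.add_apply, φ.add_int]

theorem hasDerivAt_comp_flow {U : (ι → ℝ) → ℝ} (hU : ContDiff ℝ 1 U) (y : ι → ℝ) (t : ℝ) :
    HasDerivAt (fun t => U fun i => φ.flow t (y i)) (φ.fieldDeriv U fun i => φ.flow t (y i)) t := by
  have h1 : HasDerivAt (fun t => fun i => φ.flow t (y i)) (fun i => φ (φ.flow t (y i))) t :=
    hasDerivAt_pi.2 fun i => φ.hasDerivAt_flow (y i) t
  exact ((hU.differentiable one_ne_zero _).hasFDerivAt).comp_hasDerivAt t h1

end SmoothFun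

/-- The lift to the line of a function on a power of the circle. -/
def liftTorus {ι : Type*} (U : (ι → S1) → ℝ) (y : ι → ℝ) : ℝ := U fun i => (y i : S1)

section torus

variable (φ : SmoothFun) {ι : Type*} {U : (ι → S1) → ℝ}

theorem liftTorus_rep (U : (ι → S1) → ℝ) (z : ι → S1) : liftTorus U (fun i => rep (z i)) = U z := by
  simp [liftTorus]

theorem liftTorus_add_int (U : (ι → S1) → ℝ) (y : ι → ℝ) (n : ι → ℤ) :
    liftTorus U (y + fun i => (n i : ℝ)) = liftTorus U y := by
  unfold liftTorus
  congr 1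
  funext i
  rw [coe_eq_coe_iff]
  exact ⟨n i, rfl⟩

variable [Fintype ι]

/-- The derivative of a function on a power of the circle along the vector field `(φ,…,φ)`. -/
def torusDeriv (U : (ι → S1) → ℝ) (z : ι → S1) : ℝ :=
  φ.fieldDeriv (liftTorus U) fun i => rep (z i)

theorem torusDeriv_coe (y : ι → ℝ) :
    torusDeriv φ U (fun i => (y i : S1)) = φ.fieldDeriv (liftTorus U) y := by
  obtain ⟨n, hn⟩ := exists_rep_coe_pi y
  rw [torusDeriv, hn, φ.fieldDeriv_add_int (liftTorus_add_int U)]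

theorem measurable_of_contDiff_liftTorus (hU : ContDiff ℝ 1 (liftTorus U)) : Measurable U := by
  have := measurable_comp_rep hU.continuous
  simpa only [liftTorus_rep] using this

theorem exists_bound_of_contDiff_liftTorus (hU : ContDiff ℝ 1 (liftTorus U)) :
    ∃ C : ℝ, ∀ z, |U z| ≤ C := by
  have := exists_bound_rep hU.continuous
  simpa only [liftTorus_rep] using this

theorem measurable_torusDeriv (hU : ContDiff ℝ 1 (liftTorus U)) : Measurable (torusDeriv φ U) :=
  measurable_comp_rep (φ.continuous_fieldDeriv hU)

theorem exists_bound_torusDeriv (hU : ContDiff ℝ 1 (liftTorus U)) :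
    ∃ C : ℝ, ∀ z, |torusDeriv φ U z| ≤ C :=
  exists_bound_rep (φ.continuous_fieldDeriv hU)

theorem hasDerivAt_torusFlow (hU : ContDiff ℝ 1 (liftTorus U)) (z : ι → S1) (t : ℝ) :
    HasDerivAt (fun t => U (φ.torusFlow t z)) (torusDeriv φ U (φ.torusFlow t z)) t := by
  have h := φ.hasDerivAt_comp_flow hU (fun i => rep (z i)) t
  rw [← torusDeriv_coe] at h
  exact h

end torus

/-! ### Cylinder functions and their directional derivatives. -/

theorem flowComp_apply (φ : SmoothFun) (t : ℝ) (g : G) (x : S1) :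
    (flowComp φ t g : S1 → S1) x = φ.circleFlow t ((g : S1 → S1) x) := rfl

theorem flowComp_zero (φ : SmoothFun) (g : G) : flowComp φ 0 g = g := by
  ext x
  rw [flowComp_apply, SmoothFun.circleFlow_eq, SmoothFun.flow_zero, coe_rep]

theorem hasDerivAt_cylinder (φ : SmoothFun) {m : ℕ} {x : Fin m → S1} {U : (Fin m → S1) → ℝ}
    (hU : ContDiff ℝ 1 (liftTorus U)) {u : G → ℝ}
    (hu : ∀ g : G, u g = U fun i => (g : S1 → S1) (x i)) (g : G) :
    HasDerivAt (fun t => u (flowComp φ t g))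
      (torusDeriv φ U fun i => (g : S1 → S1) (x i)) 0 := by
  have h := hasDerivAt_torusFlow φ hU (fun i => (g : S1 → S1) (x i)) 0
  have h0 : φ.torusFlow 0 (fun i => (g : S1 → S1) (x i)) = fun i => (g : S1 → S1) (x i) := by
    funext i
    rw [SmoothFun.torusFlow, SmoothFun.circleFlow_eq, SmoothFun.flow_zero, coe_rep]
  rw [h0] at h
  refine h.congr_of_eventuallyEq (Eventually.of_forall fun t => ?_)
  exact hu _

theorem tendsto_diffQuot (φ : SmoothFun) {u : G → ℝ} {g : G} {d : ℝ}
    (h : HasDerivAt (fun t => u (flowComp φ t g)) d 0) :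
    Tendsto (diffQuot φ u g) (𝓝[≠] 0) (𝓝 d) := by
  rw [hasDerivAt_iff_tendsto_slope_zero] at h
  refine h.congr fun t => ?_
  simp only [zero_add, flowComp_zero, smul_eq_mul, diffQuot]
  rw [div_eq_inv_mul]

theorem dirDeriv_eq (φ : SmoothFun) {u : G → ℝ} {g : G} {d : ℝ}
    (h : HasDerivAt (fun t => u (flowComp φ t g)) d 0) : dirDeriv φ u g = d :=
  (tendsto_diffQuot φ h).limUnder_eq

theorem IsCylinder.hasDerivAt {u : G → ℝ} (hu : IsCylinder 1 u) (φ : SmoothFun) (g : G) :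
    HasDerivAt (fun t => u (flowComp φ t g)) (dirDeriv φ u g) 0 := by
  obtain ⟨m, x, U, hU, hu⟩ := hu
  have h := hasDerivAt_cylinder φ hU hu g
  rwa [dirDeriv_eq φ h]

/-- Cylinder functions can be combined by smooth functions of two variables. -/
theorem IsCylinder.comp₂ {k : WithTop ℕ∞} {u v : G → ℝ} (hu : IsCylinder k u)
    (hv : IsCylinder k v) {ψ : ℝ → ℝ → ℝ} (hψ : ContDiff ℝ k fun p : ℝ × ℝ => ψ p.1 p.2) :
    IsCylinder k fun g => ψ (u g) (v g) := by
  obtain ⟨m, x, U, hU, hu⟩ := hu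
  obtain ⟨n, y, V, hV, hv⟩ := hv
  refine ⟨m + n, Fin.append x y, fun z => ψ (U fun i => z (Fin.castAdd n i))
    (V fun i => z (Fin.natAdd m i)), ?_, fun g => ?_⟩
  · have h1 : ContDiff ℝ k fun z : Fin (m + n) → ℝ => U fun i => (z (Fin.castAdd n i) : S1) :=
      hU.comp (contDiff_pi.2 fun i => contDiff_apply ℝ ℝ (Fin.castAdd n i))
    have h2 : ContDiff ℝ k fun z : Fin (m + n) → ℝ => V fun i => (z (Fin.natAdd m i) : S1) :=
      hV.comp (contDiff_pi.2 fun i => contDiff_apply ℝ ℝ (Fin.natAdd m i))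
    exact hψ.comp (h1.prodMk h2)
  · simp [hu, hv]

theorem IsCylinder.add {k : WithTop ℕ∞} {u v : G → ℝ} (hu : IsCylinder k u)
    (hv : IsCylinder k v) : IsCylinder k fun g => u g + v g :=
  hu.comp₂ hv (contDiff_fst.add contDiff_snd)

theorem IsCylinder.mul {k : WithTop ℕ∞} {u v : G → ℝ} (hu : IsCylinder k u)
    (hv : IsCylinder k v) : IsCylinder k fun g => u g * v g :=
  hu.comp₂ hv (contDiff_fst.mul contDiff_snd)

theorem IsCylinder.const_mul {k : WithTop ℕ∞} {u : G → ℝ} (hu : IsCylinder k u) (c : ℝ) :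
    IsCylinder k fun g => c * u g :=
  hu.comp₂ hu (ψ := fun a _ => c * a) (contDiff_const.mul contDiff_fst)

theorem isCylinder_zero {k : WithTop ℕ∞} : IsCylinder k fun _ => 0 :=
  ⟨0, Fin.elim0, fun _ => 0, contDiff_const, fun _ => rfl⟩

theorem dirDeriv_add (φ : SmoothFun) {u v : G → ℝ} (hu : IsCylinder 1 u) (hv : IsCylinder 1 v)
    (g : G) : dirDeriv φ (fun g => u g + v g) g = dirDeriv φ u g + dirDeriv φ v g :=
  dirDeriv_eq φ ((hu.hasDerivAt φ g).add (hv.hasDerivAt φ g))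

theorem dirDeriv_mul (φ : SmoothFun) {u v : G → ℝ} (hu : IsCylinder 1 u) (hv : IsCylinder 1 v)
    (g : G) : dirDeriv φ (fun g => u g * v g) g = dirDeriv φ u g * v g + u g * dirDeriv φ v g := by
  have h := (hu.hasDerivAt φ g).mul (hv.hasDerivAt φ g)
  simp only [flowComp_zero] at h
  exact dirDeriv_eq φ h

theorem dirDeriv_const_mul (φ : SmoothFun) {u : G → ℝ} (hu : IsCylinder 1 u) (c : ℝ)
    (g : G) : dirDeriv φ (fun g => c * u g) g = c * dirDeriv φ u g :=
  dirDeriv_eq φ ((hu.hasDerivAt φ g).const_mul c)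

theorem dirDeriv_zero (φ : SmoothFun) (g : G) : dirDeriv φ (fun _ => 0) g = 0 :=
  dirDeriv_eq φ (hasDerivAt_const _ _)

theorem IsCylinder.measurable_bounded {u : G → ℝ} (hu : IsCylinder 1 u) (φ : SmoothFun) :
    Measurable u ∧ Measurable (dirDeriv φ u) ∧ ∃ C : ℝ, (∀ g, |u g| ≤ C) ∧
      ∀ g, |dirDeriv φ u g| ≤ C := by
  obtain ⟨m, x, U, hU, hu⟩ := hu
  have hev : Measurable fun (g : G) (i : Fin m) => (g : S1 → S1) (x i) :=
    measurable_pi_lambda _ fun i => measurable_eval _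
  have hd : dirDeriv φ u = fun g : G => torusDeriv φ U fun i => (g : S1 → S1) (x i) :=
    funext fun g => dirDeriv_eq φ (hasDerivAt_cylinder φ hU hu g)
  obtain ⟨C, hC⟩ := exists_bound_of_contDiff_liftTorus hU
  obtain ⟨B, hB⟩ := exists_bound_torusDeriv φ hU
  refine ⟨?_, ?_, max C B, fun g => ?_, fun g => ?_⟩
  · rw [funext hu]
    exact (measurable_of_contDiff_liftTorus hU).comp hev
  · rw [hd]
    exact (measurable_torusDeriv φ hU).comp hev
  · rw [hu]; exact (hC _).trans (le_max_left _ _)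
  · rw [hd]; exact (hB _).trans (le_max_right _ _)

/-! ### Integration by parts on `𝒢` -/

/-- The increments over the cells sum to `1`, so the linear trapezoid bound is uniform in the lift
and in `N`; this supplies the dominating constant. -/
theorem abs_cellSum_le (φ : SmoothFun) : ∃ C : ℝ, ∀ F : ℝ → ℝ, IsLiftFun F → ∀ N : ℕ, 0 < N →
    |cellSum φ F N| ≤ C ∧ |cellMean φ F N| ≤ C := by
  obtain ⟨C, hC0, hC⟩ := φ.exists_abs_trapErr_le
  obtain ⟨K, hK0, hK⟩ := φ.der.exists_abs_le
  refine ⟨max C K, fun F hF N hN => ⟨?_, ?_⟩⟩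
  · refine le_trans ((Finset.abs_sum_le_sum_abs _ _).trans ?_) (le_max_left _ _)
    calc ∑ i ∈ Finset.range N, |φ.trapErr (F ((i : ℝ) / N)) (F (((i + 1 : ℕ) : ℝ) / N))|
        ≤ ∑ i ∈ Finset.range N, C * (F (((i + 1 : ℕ) : ℝ) / N) - F ((i : ℝ) / N)) :=
          Finset.sum_le_sum fun i _ => (hC _ _ (sub_nonneg.1 (hF.cell_nonneg N i))).1
      _ = C := by rw [← Finset.mul_sum, hF.sum_cells hN, mul_one]
  · refine le_trans ((Finset.abs_sum_le_sum_abs _ _).trans ?_) (le_max_right _ _)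
    have hN' : (0 : ℝ) < N := by exact_mod_cast hN
    calc ∑ i ∈ Finset.range N,
          |1 / (N : ℝ) * φ.avgSlope (F ((i : ℝ) / N)) (F (((i + 1 : ℕ) : ℝ) / N))|
        ≤ ∑ i ∈ Finset.range N, 1 / (N : ℝ) * K := by
          refine Finset.sum_le_sum fun i _ => ?_
          rw [abs_mul, abs_of_pos (by positivity)]
          exact mul_le_mul_of_nonneg_left (φ.abs_avgSlope_le hK _ _) (by positivity)
      _ = K := by
          rw [Finset.sum_const, Finset.card_range, nsmul_eq_mul]
          field_simp

theorem regularPartition_ofNat {N : ℕ} [NeZero N] (k : ℕ) :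
    regularPartition N (Fin.ofNat N k) = (((k : ℝ) / N : ℝ) : S1) := by
  have hN : (N : ℝ) ≠ 0 := by exact_mod_cast NeZero.ne N
  rw [regularPartition, coe_eq_coe_iff]
  refine ⟨-((k / N : ℕ) : ℤ), ?_⟩
  have h : ((N * (k / N) + k % N : ℕ) : ℝ) = (k : ℝ) := by rw [Nat.div_add_mod]
  push_cast at h
  simp only [Fin.ofNat]
  rw [Int.cast_neg, Int.cast_natCast]
  field_simp
  linarith

theorem rep_nonneg (x : S1) : 0 ≤ rep x := (AddCircle.equivIco (1 : ℝ) 0 x).2.1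

/-- The index of a point of the regular partition that approximates `x` from the right. -/
def approxIndex (N : ℕ) [NeZero N] (x : S1) : Fin N := Fin.ofNat N ⌈(N : ℝ) * rep x⌉.toNat

theorem regularPartition_approxIndex (N : ℕ) [NeZero N] (x : S1) :
    regularPartition N (approxIndex N x) = (((⌈(N : ℝ) * rep x⌉ : ℝ) / N : ℝ) : S1) := by
  rw [approxIndex, regularPartition_ofNat]
  have h : (0 : ℤ) ≤ ⌈(N : ℝ) * rep x⌉ := Int.ceil_nonneg (mul_nonneg N.cast_nonneg (rep_nonneg x))
  have h2 : ((⌈(N : ℝ) * rep x⌉.toNat : ℤ) : ℝ) = (⌈(N : ℝ) * rep x⌉ : ℝ) := by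
    rw [Int.toNat_of_nonneg h]
  rw [← h2, Int.cast_natCast]

/-- The partition points approach each `x i` from the right, where the lift is continuous. The limit
is taken on the line through `f`. -/
theorem tendsto_comp_approx {ι : Type*} [Fintype ι] {f : (ι → ℝ) → ℝ} (hf : Continuous f)
    {D : (ι → S1) → ℝ} (hD : ∀ y : ι → ℝ, D (fun i => (y i : S1)) = f y) (g : G) (x : ι → S1) :
    Tendsto (fun n : ℕ => D fun i => (g : S1 → S1) (regularPartition (n + 1)
      (approxIndex (n + 1) (x i)))) atTop (𝓝 (D fun i => (g : S1 → S1) (x i))) := by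
  have hF := isLift_lift g
  have h1 : ∀ i, (g : S1 → S1) (x i) = ((lift g (rep (x i)) : ℝ) : S1) := fun i => by
    rw [← apply_coe_of_isLift hF, coe_rep]
  simp only [regularPartition_approxIndex, apply_coe_of_isLift hF, h1, hD]
  refine (hf.tendsto _).comp (tendsto_pi_nhds.2 fun i => ?_)
  exact ((hF.1.rightCont (rep (x i))).tendsto.comp
    (tendsto_ceil_mul_div (rep (x i))).1).comp (tendsto_add_atTop_nat 1)

/-- Integration by parts for cylinder functions. -/
theorem integral_dirDeriv_add (φ : SmoothFun) {β : ℝ} {Q : Measure G}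
    (hQ : IsDirichletProcess β Q) {u : G → ℝ} (hu : IsCylinder 1 u) :
    AEStronglyMeasurable (drift β φ) Q ∧ ∫ g, (dirDeriv φ u g + u g * drift β φ g) ∂Q = 0 := by
  have hQp := hQ.isProb
  obtain ⟨m, x, U, hU, hu⟩ := hu
  have hd : ∀ g : G, dirDeriv φ u g = torusDeriv φ U fun i => (g : S1 → S1) (x i) :=
    fun g => dirDeriv_eq φ (hasDerivAt_cylinder φ hU hu g)
  obtain ⟨C, hC⟩ := exists_bound_of_contDiff_liftTorus hU
  obtain ⟨B, hB⟩ := exists_bound_torusDeriv φ hU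
  obtain ⟨A, hA⟩ := abs_cellSum_le φ
  have hC0 : 0 ≤ C := (abs_nonneg _).trans (hC fun _ => 0)
  set W : ℕ → G → ℝ := fun n g =>
    cellSum φ (lift g) (n + 1) + β * cellMean φ (lift g) (n + 1) with hW
  have hWlim : ∀ g, Tendsto (fun n => W n g) atTop (𝓝 (drift β φ g)) := fun g =>
    ((tendsto_cellSum φ (isLift_lift g).1).comp (tendsto_add_atTop_nat 1)).add
      (((tendsto_cellMean φ (isLift_lift g).1).comp (tendsto_add_atTop_nat 1)).const_mul β)
  have hWb : ∀ n g, |W n g| ≤ A + |β| * A := fun n g => by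
    obtain ⟨h1, h2⟩ := hA _ (isLift_lift g).1 (n + 1) n.succ_pos
    refine (abs_add_le _ _).trans (add_le_add h1 ?_)
    rw [abs_mul]
    exact mul_le_mul_of_nonneg_left h2 (abs_nonneg _)
  -- The evaluation points are moved to the partition with `n + 1 > 0` cells, where the finite
  -- dimensional integration by parts applies.
  set p : ℕ → G → Fin m → S1 := fun n g i =>
    (g : S1 → S1) (regularPartition (n + 1) (approxIndex (n + 1) (x i))) with hp
  have hpm : ∀ n, Measurable (p n) := fun n => measurable_pi_lambda _ fun i => measurable_eval _
  have key : ∀ n, _ := fun n => integral_regularPartition (N := n + 1) φ hQ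
    (f := fun z => U fun i => z (approxIndex (n + 1) (x i)))
    (f' := fun t z => torusDeriv φ U fun i => φ.torusFlow t z (approxIndex (n + 1) (x i)))
    ((measurable_of_contDiff_liftTorus hU).comp
      (measurable_pi_lambda _ fun i => measurable_pi_apply _))
    ((measurable_torusDeriv φ hU).comp
      (measurable_pi_lambda _ fun i => (measurable_pi_apply _).comp (φ.measurable_torusFlow 0)))
    (fun z => hC _) (fun t z => hB _)
    (fun z t => hasDerivAt_torusFlow φ hU (fun i => z (approxIndex (n + 1) (x i))) t)
  have hWm : ∀ n, AEStronglyMeasurable (W n) Q := fun n =>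
    (((φ.measurable_logDens' _ 0).comp (measurable_pi_lambda _ fun i =>
      measurable_eval _)).aestronglyMeasurable).congr (key n).1
  have hflow0 : ∀ (n : ℕ) (z : Fin (n + 1) → S1), φ.torusFlow 0 z = z := fun n z => by
    funext i
    rw [SmoothFun.torusFlow, SmoothFun.circleFlow_eq, SmoothFun.flow_zero, coe_rep]
  have hzero : ∀ n, ∫ g, (torusDeriv φ U (p n g) + U (p n g) * W n g) ∂Q = 0 := fun n => by
    have h := (key n).2
    simp only [hflow0] at h
    exact h
  refine ⟨aestronglyMeasurable_of_tendsto_ae atTop hWm (ae_of_all _ hWlim), ?_⟩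
  have hlim : Tendsto (fun n => ∫ g, (torusDeriv φ U (p n g) + U (p n g) * W n g) ∂Q) atTop
      (𝓝 (∫ g, (dirDeriv φ u g + u g * drift β φ g) ∂Q)) := by
    refine tendsto_integral_of_dominated_convergence (fun _ => B + C * (A + |β| * A))
      (fun n => ?_) (integrable_const _) (fun n => ae_of_all _ fun g => ?_)
      (ae_of_all _ fun g => ?_)
    · exact ((measurable_torusDeriv φ hU).comp (hpm n)).aestronglyMeasurable.add
        (((measurable_of_contDiff_liftTorus hU).comp (hpm n)).aestronglyMeasurable.mul (hWm n))
    · refine (norm_add_le _ _).trans (add_le_add (hB _) ?_)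
      rw [norm_mul]
      exact mul_le_mul (hC _) (hWb n g) (norm_nonneg _) hC0
    · rw [hd, hu]
      exact (tendsto_comp_approx (φ.continuous_fieldDeriv hU) (fun y => torusDeriv_coe φ y) g x).add
        ((tendsto_comp_approx hU.continuous (fun y => rfl) g x).mul (hWlim g))
  simp only [hzero] at hlim
  exact (tendsto_nhds_unique hlim tendsto_const_nhds)

/-! ### Cylinder functions determine finite measures -/

section ext

variable {ι : Type*} [Fintype ι]

/-- The continuously differentiable functions on a power of the circle. -/
def smoothTorus (ι : Type*) [Fintype ι] :
    StarSubalgebra ℝ (BoundedContinuousFunction (ι → S1) ℝ) where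
  carrier := {f | ContDiff ℝ 1 (liftTorus f)}
  mul_mem' {a b} hf hg := by
    have h1 : ContDiff ℝ 1 (liftTorus a) := hf
    exact h1.mul (show ContDiff ℝ 1 (liftTorus b) from hg)
  add_mem' {a b} hf hg := by
    have h1 : ContDiff ℝ 1 (liftTorus a) := hf
    exact h1.add (show ContDiff ℝ 1 (liftTorus b) from hg)
  algebraMap_mem' r := show ContDiff ℝ 1 fun _ : ι → ℝ => r from contDiff_const
  star_mem' hf := hf

theorem cos_rep_coe (r y : ℝ) :
    Real.cos (2 * Real.pi * (rep (y : S1) - r)) = Real.cos (2 * Real.pi * (y - r)) := by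
  obtain ⟨n, hn⟩ := exists_rep_coe y
  rw [hn, show 2 * Real.pi * (y + n - r) = 2 * Real.pi * (y - r) + n * (2 * Real.pi) by ring,
    Real.cos_add_int_mul_two_pi]

theorem continuous_cos_rep (r : ℝ) :
    Continuous fun y : S1 => Real.cos (2 * Real.pi * (rep y - r)) := by
  have hq : IsQuotientMap ((↑) : ℝ → S1) := QuotientAddGroup.isQuotientMap_mk _
  rw [hq.continuous_iff]
  have : (fun y : S1 => Real.cos (2 * Real.pi * (rep y - r))) ∘ ((↑) : ℝ → S1) =
      fun y => Real.cos (2 * Real.pi * (y - r)) := funext fun y => cos_rep_coe r y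
  rw [this]
  fun_prop

/-- In a coordinate where the points differ, a cosine centred at one of them equals `1` only there.
-/
theorem separatesPoints_smoothTorus : ((smoothTorus ι).map
    (BoundedContinuousFunction.toContinuousMapStarₐ ℝ)).SeparatesPoints := by
  intro z w hzw
  obtain ⟨i, hi⟩ : ∃ i, z i ≠ w i := by
    by_contra! h
    exact hzw (funext h)
  set c : (ι → S1) → ℝ := fun x => Real.cos (2 * Real.pi * (rep (x i) - rep (w i))) with hc
  have hcont : Continuous c := (continuous_cos_rep (rep (w i))).comp (continuous_apply i)
  have hsm : ContDiff ℝ 1 (liftTorus c) := by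
    have : liftTorus c = fun y : ι → ℝ => Real.cos (2 * Real.pi * (y i - rep (w i))) :=
      funext fun y => cos_rep_coe _ _
    rw [this]
    fun_prop
  refine ⟨c, ⟨_, ⟨BoundedContinuousFunction.ofNormedAddCommGroup c hcont 1
    fun x => Real.abs_cos_le_one _, hsm, rfl⟩, rfl⟩, ?_⟩
  intro heq
  have h1 : c w = 1 := by simp [hc]
  rw [h1] at heq
  obtain ⟨n, hn⟩ := (Real.cos_eq_one_iff _).1 heq
  refine hi ?_
  rw [← coe_rep (z i), ← coe_rep (w i), coe_eq_coe_iff]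
  refine ⟨n, ?_⟩
  have h2 : (2 * Real.pi) * n = (2 * Real.pi) * (rep (z i) - rep (w i)) := by
    rw [← hn]; ring
  have := mul_left_cancel₀ Real.two_pi_pos.ne' h2
  linarith

theorem measure_torus_ext {μ ν : Measure (ι → S1)} [IsFiniteMeasure μ] [IsFiniteMeasure ν]
    (h : ∀ f : (ι → S1) → ℝ, ContDiff ℝ 1 (liftTorus f) → ∫ x, f x ∂μ = ∫ x, f x ∂ν) : μ = ν :=
  ext_of_forall_mem_subalgebra_integral_eq_of_pseudoEMetric_complete_countable (𝕜 := ℝ)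
    separatesPoints_smoothTorus fun f hf => h f hf

end ext

theorem isCylinder_restrict (I : Finset S1) {f : (I → S1) → ℝ} (hf : ContDiff ℝ 1 (liftTorus f)) :
    IsCylinder 1 fun g : G => f fun i => (g : S1 → S1) i := by
  refine ⟨I.card, fun k => (I.equivFin.symm k : S1), fun z => f fun i => z (I.equivFin i), ?_,
    fun g => by simp⟩
  exact hf.comp (contDiff_pi.2 fun i => contDiff_apply ℝ ℝ (I.equivFin i))

/-- Cylinder functions determine the finite dimensional marginals, by `measure_torus_ext`, and a
finite measure on the product is determined by these. -/
theorem measure_G_ext {μ ν : Measure G} [IsFiniteMeasure μ] [IsFiniteMeasure ν]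
    (h : ∀ u : G → ℝ, IsCylinder 1 u → ∫ g, u g ∂μ = ∫ g, u g ∂ν) : μ = ν := by
  have hval : Measurable (Subtype.val : G → S1 → S1) := measurable_subtype_coe
  have hmap : μ.map Subtype.val = ν.map Subtype.val := by
    refine IsProjectiveLimit.unique
      (P := fun I : Finset S1 => (μ.map Subtype.val).map I.restrict) (fun I => rfl) fun I => ?_
    have hr : Measurable (I.restrict : (S1 → S1) → I → S1) := Finset.measurable_restrict I
    change (ν.map Subtype.val).map I.restrict = (μ.map Subtype.val).map I.restrict
    rw [Measure.map_map hr hval, Measure.map_map hr hval]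
    refine measure_torus_ext fun f hf => ?_
    have hfm := (measurable_of_contDiff_liftTorus hf).aestronglyMeasurable (μ := ν.map
      (I.restrict ∘ Subtype.val))
    have hfm' := (measurable_of_contDiff_liftTorus hf).aestronglyMeasurable (μ := μ.map
      (I.restrict ∘ Subtype.val))
    rw [integral_map (hr.comp hval).aemeasurable hfm, integral_map (hr.comp hval).aemeasurable hfm']
    exact (h _ (isCylinder_restrict I hf)).symm
  ext s hs
  obtain ⟨t, ht, rfl⟩ := hs
  rw [← Measure.map_apply hval ht, ← Measure.map_apply hval ht, hmap]

/-- The measures with densities `f⁺` and `f⁻` agree on cylinder functions, hence coincide; then `f⁺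
= f⁻` almost everywhere. -/
theorem ae_eq_zero_of_forall_cylinder {Q : Measure G} [IsFiniteMeasure Q] {f : G → ℝ}
    (hf : Integrable f Q) (h : ∀ u : G → ℝ, IsCylinder 1 u → ∫ g, f g * u g ∂Q = 0)
    (φ : SmoothFun) : f =ᵐ[Q] 0 := by
  have h1 : IsFiniteMeasure (Q.withDensity fun g => ENNReal.ofReal (f g)) :=
    isFiniteMeasure_withDensity_ofReal hf.2
  have h2 : IsFiniteMeasure (Q.withDensity fun g => ENNReal.ofReal (-f g)) :=
    isFiniteMeasure_withDensity_ofReal hf.neg.2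
  have hm1 : AEMeasurable (fun g => ENNReal.ofReal (f g)) Q := hf.1.aemeasurable.ennreal_ofReal
  have hm2 : AEMeasurable (fun g => ENNReal.ofReal (-f g)) Q :=
    hf.1.aemeasurable.neg.ennreal_ofReal
  have heq : (Q.withDensity fun g => ENNReal.ofReal (f g)) =
      Q.withDensity fun g => ENNReal.ofReal (-f g) := by
    refine measure_G_ext fun u hu => ?_
    obtain ⟨hum, -, C, hC, -⟩ := hu.measurable_bounded φ
    rw [integral_withDensity_eq_integral_toReal_smul₀ hm1
        (ae_of_all _ fun g => ENNReal.ofReal_lt_top),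
      integral_withDensity_eq_integral_toReal_smul₀ hm2
        (ae_of_all _ fun g => ENNReal.ofReal_lt_top), ← sub_eq_zero, ← integral_sub, ← h u hu]
    · refine integral_congr_ae (ae_of_all _ fun g => ?_)
      simp only [ENNReal.toReal_ofReal', smul_eq_mul, ← sub_mul]
      congr 1
      rcases le_total 0 (f g) with h0 | h0
      · rw [max_eq_left h0, max_eq_right (by linarith), sub_zero]
      · rw [max_eq_right h0, max_eq_left (by linarith)]; ring
    · simp only [ENNReal.toReal_ofReal', smul_eq_mul]
      exact hf.pos_part.mul_bdd (c := C) hum.aestronglyMeasurable (ae_of_all _ hC)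
    · simp only [ENNReal.toReal_ofReal', smul_eq_mul]
      exact hf.neg.pos_part.mul_bdd (c := C) hum.aestronglyMeasurable (ae_of_all _ hC)
  have hae := (withDensity_eq_iff hm1 hm2 (by
    rw [← setLIntegral_univ, ← withDensity_apply _ MeasurableSet.univ]
    exact measure_ne_top _ _)).1 heq
  filter_upwards [hae] with g hg
  rcases lt_trichotomy (f g) 0 with h0 | h0 | h0
  · rw [ENNReal.ofReal_of_nonpos h0.le, eq_comm, ENNReal.ofReal_eq_zero] at hg
    linarith
  · exact h0
  · rw [ENNReal.ofReal_of_nonpos (p := -f g) (by linarith), ENNReal.ofReal_eq_zero] at hg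
    linarith

/-! ### The operator `D_φ` in `L²` -/

section operator

variable {φ : SmoothFun} {β : ℝ} {Q : Measure G}

theorem IsCylinder.memLp {u : G → ℝ} (hu : IsCylinder 1 u) (φ : SmoothFun) [IsFiniteMeasure Q] :
    MemLp u 2 Q ∧ MemLp (dirDeriv φ u) 2 Q := by
  obtain ⟨h1, h2, C, hC, hC'⟩ := hu.measurable_bounded φ
  exact ⟨MemLp.of_bound h1.aestronglyMeasurable C (ae_of_all _ hC),
    MemLp.of_bound h2.aestronglyMeasurable C (ae_of_all _ hC')⟩

theorem inner_eq_integral {f h : Lp ℝ 2 Q} {u v : G → ℝ} (hf : f =ᵐ[Q] u) (hh : h =ᵐ[Q] v) :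
    inner ℝ f h = ∫ g, v g * u g ∂Q := by
  rw [L2.inner_def]
  refine integral_congr_ae ?_
  filter_upwards [hf, hh] with g h1 h2
  rw [h1, h2]
  simp

/-- The formal adjoint of `D_φ` on cylinder functions. -/
def adjointFun (β : ℝ) (φ : SmoothFun) (u : G → ℝ) (g : G) : ℝ :=
  -dirDeriv φ u g - drift β φ g * u g

theorem memLp_adjointFun (hβ : 0 < β) (hQ : IsDirichletProcess β Q) {u : G → ℝ}
    (hu : IsCylinder 1 u) : MemLp (adjointFun β φ u) 2 Q := by
  have hQp := hQ.isProb
  obtain ⟨h1, h2, C, hC, hC'⟩ := hu.measurable_bounded φ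
  have hdrift : ∀ g, |drift β φ g| ≤ (1 / 2 + β) * ∫ x in (0 : ℝ)..1, |deriv (deriv φ) x| :=
    fun g => abs_liftDrift_le hβ.le φ (isLift_lift g).1
  refine MemLp.of_bound (h2.aestronglyMeasurable.neg.sub
    ((integral_dirDeriv_add φ hQ hu).1.mul h1.aestronglyMeasurable))
    (C + ((1 / 2 + β) * ∫ x in (0 : ℝ)..1, |deriv (deriv φ) x|) * C) (ae_of_all _ fun g => ?_)
  refine (norm_sub_le _ _).trans (add_le_add ?_ ?_)
  · rw [norm_neg]; exact hC' g
  · rw [norm_mul]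
    exact mul_le_mul (hdrift g) (hC g) (norm_nonneg _) ((abs_nonneg _).trans (hdrift g))

/-- The integration by parts formula applied to the cylinder function `u * v`, with the Leibniz
rule. -/
theorem integral_dirDeriv_mul (hβ : 0 < β) (hQ : IsDirichletProcess β Q) {u v : G → ℝ}
    (hu : IsCylinder 1 u) (hv : IsCylinder 1 v) :
    ∫ g, dirDeriv φ u g * v g ∂Q = ∫ g, u g * adjointFun β φ v g ∂Q := by
  have hQp := hQ.isProb
  have h := (integral_dirDeriv_add φ hQ (hu.mul hv)).2
  have hi1 : Integrable (fun g => dirDeriv φ u g * v g) Q :=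
    (hu.memLp φ).2.integrable_mul (hv.memLp φ).1
  have hi2 : Integrable (fun g => u g * adjointFun β φ v g) Q :=
    (hu.memLp φ).1.integrable_mul (memLp_adjointFun hβ hQ hv)
  rw [← sub_eq_zero, ← integral_sub hi1 hi2, ← h]
  refine integral_congr_ae (ae_of_all _ fun g => ?_)
  simp only [dirDeriv_mul φ hu hv, adjointFun]
  ring

/-- The graph of `D_φ` as a submodule. -/
def dirSubmodule (φ : SmoothFun) (Q : Measure G) : Submodule ℝ (Lp ℝ 2 Q × Lp ℝ 2 Q) where
  carrier := dirGraph φ Q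
  zero_mem' := ⟨fun _ => 0, isCylinder_zero, Lp.coeFn_zero _ _ _, by
    rw [funext (dirDeriv_zero φ)]
    exact Lp.coeFn_zero _ _ _⟩
  add_mem' := by
    rintro p q ⟨u, hu, hu1, hu2⟩ ⟨v, hv, hv1, hv2⟩
    refine ⟨_, hu.add hv, (Lp.coeFn_add _ _).trans (hu1.add hv1), ?_⟩
    rw [funext (dirDeriv_add φ hu hv)]
    exact (Lp.coeFn_add _ _).trans (hu2.add hv2)
  smul_mem' := by
    rintro c p ⟨u, hu, hu1, hu2⟩
    refine ⟨_, hu.const_mul c, (Lp.coeFn_smul _ _).trans (hu1.const_smul c), ?_⟩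
    rw [funext (dirDeriv_const_mul φ hu c)]
    exact (Lp.coeFn_smul _ _).trans (hu2.const_smul c)

theorem span_dirGraph : Submodule.span ℝ (dirGraph φ Q) = dirSubmodule φ Q :=
  Submodule.span_eq (dirSubmodule φ Q)

theorem eq_zero_of_forall_cylinder [IsFiniteMeasure Q] (φ : SmoothFun) {f : Lp ℝ 2 Q}
    (h : ∀ u : G → ℝ, IsCylinder 1 u → ∫ g, f g * u g ∂Q = 0) : f = 0 := by
  rw [Lp.eq_zero_iff_ae_eq_zero]
  exact ae_eq_zero_of_forall_cylinder ((Lp.memLp f).integrable one_le_two) h φ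

/-- Single-valuedness: if `u` vanishes almost everywhere, integration by parts makes `D_φ u`
orthogonal to every cylinder function. Only then does `toLinearPMap` have the intended graph. -/
theorem dirSubmodule_snd_eq_zero (hβ : 0 < β) (hQ : IsDirichletProcess β Q) :
    ∀ p ∈ dirSubmodule φ Q, p.1 = 0 → p.2 = 0 := by
  have hQp := hQ.isProb
  rintro p ⟨u, hu, hu1, hu2⟩ h0
  have hu0 : u =ᵐ[Q] 0 := by
    rw [h0] at hu1
    exact hu1.symm.trans (Lp.coeFn_zero _ _ _)
  refine eq_zero_of_forall_cylinder φ fun v hv => ?_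
  calc ∫ g, p.2 g * v g ∂Q = ∫ g, dirDeriv φ u g * v g ∂Q :=
        integral_congr_ae (hu2.mul (ae_eq_refl v))
    _ = ∫ g, u g * adjointFun β φ v g ∂Q := integral_dirDeriv_mul hβ hQ hu hv
    _ = ∫ g, 0 ∂Q := integral_congr_ae (by
        filter_upwards [hu0] with g hg
        rw [hg]; simp)
    _ = 0 := by simp

theorem mem_graph_dirOp (hβ : 0 < β) (hQ : IsDirichletProcess β Q) (p : Lp ℝ 2 Q × Lp ℝ 2 Q) :
    p ∈ (dirOp φ Q).graph ↔ p ∈ dirGraph φ Q := by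
  rw [dirOp, span_dirGraph, Submodule.toLinearPMap_graph_eq _
    (fun p hp h => dirSubmodule_snd_eq_zero hβ hQ p hp h)]
  rfl

theorem mem_domain_dirOp (hβ : 0 < β) (hQ : IsDirichletProcess β Q) {f : Lp ℝ 2 Q} :
    f ∈ (dirOp φ Q).domain ↔ ∃ u : G → ℝ, IsCylinder 1 u ∧ f =ᵐ[Q] u := by
  have hQp := hQ.isProb
  constructor
  · intro hf
    obtain ⟨u, hu, h1, -⟩ :=
      (mem_graph_dirOp hβ hQ _).1 ((dirOp φ Q).mem_graph ⟨f, hf⟩)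
    exact ⟨u, hu, h1⟩
  · rintro ⟨u, hu, h1⟩
    exact LinearPMap.mem_domain_of_mem_graph ((mem_graph_dirOp hβ hQ
      (f, (hu.memLp φ).2.toLp)).2 ⟨u, hu, h1, MemLp.coeFn_toLp (hu.memLp φ).2⟩)

/-- Stated for any subspace containing the cylinder functions, since it serves both the domain of
`D_φ` and that of its adjoint; the orthogonal complement is trivial. -/
theorem dense_domain_of_cylinder [IsFiniteMeasure Q] (φ : SmoothFun) {K : Submodule ℝ (Lp ℝ 2 Q)}
    (hK : ∀ (u : G → ℝ) (f : Lp ℝ 2 Q), IsCylinder 1 u → f =ᵐ[Q] u → f ∈ K) :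
    Dense (K : Set (Lp ℝ 2 Q)) := by
  rw [Submodule.dense_iff_topologicalClosure_eq_top, Submodule.topologicalClosure_eq_top_iff,
    Submodule.eq_bot_iff]
  intro f hf
  refine eq_zero_of_forall_cylinder φ fun u hu => ?_
  have h := (Submodule.mem_orthogonal K f).1 hf _
    (hK u _ hu (MemLp.coeFn_toLp (hu.memLp φ).1))
  rwa [inner_eq_integral (MemLp.coeFn_toLp _) (ae_eq_refl f)] at h

theorem dense_domain_dirOp (hβ : 0 < β) (hQ : IsDirichletProcess β Q) :
    Dense ((dirOp φ Q).domain : Set (Lp ℝ 2 Q)) := by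
  have hQp := hQ.isProb
  exact dense_domain_of_cylinder φ fun u f hu hf => (mem_domain_dirOp hβ hQ).2 ⟨u, hu, hf⟩

theorem exists_adjoint_dirOp (hβ : 0 < β) (hQ : IsDirichletProcess β Q) {u : G → ℝ}
    (hu : IsCylinder 1 u) {f : Lp ℝ 2 Q} (hf : f =ᵐ[Q] u) :
    ∃ hf : f ∈ (dirOp φ Q).adjoint.domain,
      (dirOp φ Q).adjoint ⟨f, hf⟩ =ᵐ[Q] adjointFun β φ u := by
  have hQp := hQ.isProb
  have hw := memLp_adjointFun (φ := φ) hβ hQ hu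
  have key : ∀ x : (dirOp φ Q).domain,
      inner ℝ hw.toLp (x : Lp ℝ 2 Q) = inner ℝ f (dirOp φ Q x) := by
    intro x
    obtain ⟨v, hv, h1, h2⟩ := (mem_graph_dirOp hβ hQ _).1 ((dirOp φ Q).mem_graph x)
    rw [inner_eq_integral (MemLp.coeFn_toLp hw) h1, inner_eq_integral hf h2,
      integral_dirDeriv_mul hβ hQ hv hu]
  have hdom := LinearPMap.mem_adjoint_domain_of_exists f ⟨_, key⟩
  refine ⟨hdom, ?_⟩
  rw [LinearPMap.adjoint_apply_eq (dense_domain_dirOp hβ hQ) ⟨f, hdom⟩ key]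
  exact MemLp.coeFn_toLp hw

/-- The adjoint is densely defined, so its own adjoint is a closed operator, and this extends `D_φ`.
-/
theorem isClosable_dirOp (hβ : 0 < β) (hQ : IsDirichletProcess β Q) :
    (dirOp φ Q).IsClosable := by
  have hQp := hQ.isProb
  have hd := dense_domain_dirOp (φ := φ) hβ hQ
  have hd' : Dense ((dirOp φ Q).adjoint.domain : Set (Lp ℝ 2 Q)) :=
    dense_domain_of_cylinder φ fun u f hu hf => (exists_adjoint_dirOp hβ hQ hu hf).1
  exact (LinearPMap.adjoint_isClosed hd').isClosable.leIsClosable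
    (LinearPMap.IsFormalAdjoint.le_adjoint hd' (LinearPMap.adjoint_isFormalAdjoint hd))

end operator

end CircleMap
end

open CircleMap
theorem mainTheorem7 (φ : SmoothFun) :
    -- the drift: absolute convergence, bounds, independence of the lift
    (∀ (g : G) (F : ℝ → ℝ), IsLift F g →
      (Summable fun a : jumpSet F => |driftTerm φ F a|) ∧
      drift0 φ g = (∑' a : jumpSet F, driftTerm φ F a) ∧
      |drift0 φ g| ≤ (∑' a : jumpSet F, |driftTerm φ F a|) ∧
      (∑' a : jumpSet F, |driftTerm φ F a|) ≤ 1 / 2 * ∫ x in (0 : ℝ)..1, |deriv (deriv φ) x| ∧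
      ∀ β : ℝ, 0 ≤ β →
        drift β φ g =
          (∑' a : jumpSet F, driftTerm φ F a) + β * ∫ x in (0 : ℝ)..1, deriv φ (F x) ∧
        |drift β φ g| ≤ (1 / 2 + β) * ∫ x in (0 : ℝ)..1, |deriv (deriv φ) x|) ∧
    -- the drift is the derivative of the densities
    (∀ (g : G) (F : ℝ → ℝ), IsLift F g →
      (∀ t : ℝ, Multipliable fun a : jumpSet F => jumpFactor (φ.flow t) F a) ∧
      (∀ᶠ t : ℝ in 𝓝 0,
        Multipliable fun a : jumpSet F => jumpFactor (fun x => x + t * φ x) F a) ∧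
      ∀ β : ℝ, 0 ≤ β →
        HasDerivAt (fun t : ℝ => Ydens β (φ.flow t) F) (drift β φ g) 0 ∧
        HasDerivAt (fun t : ℝ => Ydens β (fun x => x + t * φ x) F) (drift β φ g) 0) ∧
    -- integration by parts and closability
    (∀ (β : ℝ), 0 < β → ∀ Q : Measure G, IsDirichletProcess β Q →
      (∀ u : G → ℝ, IsCylinder 1 u →
        (∀ g : G, Tendsto (diffQuot φ u g) (𝓝[≠] 0) (𝓝 (dirDeriv φ u g))) ∧
        MemLp u 2 Q ∧ MemLp (dirDeriv φ u) 2 Q) ∧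
      (∀ p : Lp ℝ 2 Q × Lp ℝ 2 Q, p ∈ (dirOp φ Q).graph ↔ p ∈ dirGraph φ Q) ∧
      Dense ((dirOp φ Q).domain : Set (Lp ℝ 2 Q)) ∧
      (∀ u : G → ℝ, IsCylinder 1 u → ∀ f : Lp ℝ 2 Q, f =ᵐ[Q] u →
        ∃ hf : f ∈ (dirOp φ Q).adjoint.domain,
          (dirOp φ Q).adjoint ⟨f, hf⟩ =ᵐ[Q] fun g => -dirDeriv φ u g - drift β φ g * u g) ∧
      (dirOp φ Q).IsClosable) := by
  refine ⟨fun g F hF => ?_, fun g F hF => ?_, fun β hβ Q hQ => ?_⟩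
  · have h0 : drift0 φ g = ∑' a : jumpSet F, driftTerm φ F a :=
      tsum_driftTerm_eq φ (isLift_lift g) hF
    refine ⟨summable_abs_driftTerm φ hF.1, h0, ?_, tsum_abs_driftTerm_le φ hF.1,
      fun β hβ => ⟨drift_eq β φ hF, ?_⟩⟩
    · rw [h0]
      exact abs_tsum_driftTerm_le φ hF.1
    · exact abs_liftDrift_le hβ φ (isLift_lift g).1
  · refine ⟨(φ.tprod_jumpFactor_flow hF.1).1, (φ.tprod_jumpFactor_perturb hF.1).1,
      fun β _ => ?_⟩
    rw [drift_eq β φ hF]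
    exact ⟨φ.hasDerivAt_Ydens_flow hF.1 β, φ.hasDerivAt_Ydens_perturb hF.1 β⟩
  · have hQp := hQ.isProb
    exact ⟨fun u hu => ⟨fun g => tendsto_diffQuot φ (hu.hasDerivAt φ g), hu.memLp φ⟩,
      mem_graph_dirOp hβ hQ, dense_domain_dirOp hβ hQ,
      fun u hu f hf => exists_adjoint_dirOp hβ hQ hu hf, isClosable_dirOp hβ hQ⟩
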